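/- Let $p$ be an odd prime, let $\mathbb{F}$ be an algebraically closed field of characteristic $p$, let $G = SL_2(\mathbb{F}_p)$ and let $B \le G$ be the subgroup of upper triangular matrices. All modules are right modules. Let $\zeta$ be a primitive root modulo $p$, and put $g = \begin{pmatrix}1&1\\0&1\end{pmatrix}$ and $\lambda = \begin{pmatrix}\zeta&0\\0&\zeta^{-1}\end{pmatrix}$, which generate $B$. For $a \in \mathbb{Z}$ let $S_a$ be the one-dimensional $\mathbb{F}[B]$-module on which $g$ acts trivially and $\lambda$ acts as multiplication by $\zeta^a$. For $1 \le b \le p$ let $U_{a,b}$ be the (unique up to isomorphism) uniserial $\mathbb{F}[B]$-module of dimension $b$ whose composition factors, in ascending order (from the socle to the top), are $S_a, S_{a+2}, \dots, S_{a+2(b-1)}$. For $1 \le t \le p$ let $V_t \subseteq \mathbb{F}[x,y]$ be the simple $\mathbb{F}[G]$-module of homogeneous polynomials of degree $t-1$, spanned by $x^{t-1}, x^{t-2}y, \dots, y^{t-1}$, with the action $$x^i y^j \cdot \begin{pmatrix}\alpha&\beta\\ \gamma&\delta\end{pmatrix} = (\alpha x+\beta y)^i(\gamma x+\delta y)^j,$$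 and let $P_{V_t}$ be its projective cover, that is, a projective $\mathbb{F}[G]$-module with an epimorphism onto $V_t$ whose kernel is superfluous (it exists and is unique up to isomorphism). Then, for every $1 \le t \le p$, as $\mathbb{F}[B]$-modules, $$\mathrm{Res}^G_B(P_{V_t}) \cong \begin{cases} U_{0,p} & \text{if } t \in \{1,p\},\\ U_{t-1,p}\oplus U_{p-t,p} & \text{if } 1<t<p.\end{cases}$$ -/

import Mathlib

universe u v w

open Matrix MulOpposite

namespace SL2Rep

noncomputable section

/-- The group `G = SL₂(𝔽_p)`. -/
abbrev G (p : ℕ) : Type := Matrix.SpecialLinearGroup (Fin 2) (ZMod p)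

/-- The subgroup `B` of upper triangular matrices of `G`. -/
def B (p : ℕ) : Subgroup (G p) where
  carrier := {A | A.1 1 0 = 0}
  one_mem' := by simp
  mul_mem' := by
    intro A A' h h'
    simp only [Set.mem_ofPred_eq] at h h' ⊢
    simp [Matrix.mul_apply, Fin.sum_univ_two, h, h']
  inv_mem' := by
    intro A h
    simp only [Set.mem_ofPred_eq] at h ⊢
    simp [Matrix.SpecialLinearGroup.coe_inv, Matrix.adjugate_fin_two, h]

/-- The generator `g = (1 1; 0 1)` of the group of upper unitriangular matrices. -/
def g (p : ℕ) : B p :=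
  ⟨⟨!![1, 1; 0, 1], by simp [Matrix.det_fin_two]⟩, rfl⟩

/-- The diagonal matrix `λ = diag(ζ, ζ⁻¹)`. -/
def lam {p : ℕ} (ζ : (ZMod p)ˣ) : B p :=
  ⟨⟨!![(ζ : ZMod p), 0; 0, ((ζ⁻¹ : (ZMod p)ˣ) : ZMod p)], by simp [Matrix.det_fin_two]⟩,
    rfl⟩

/-! Modules are right modules: a right `F[H]`-module is a representation of the opposite group
`Hᵐᵒᵖ`, in which `op h` acts as `v ↦ v · h`. Its group algebra `F[Hᵐᵒᵖ]` is the opposite ring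
of `F[H]`. -/

/-- Restriction of right modules from `G` to `B`. -/
def res {p : ℕ} {F M : Type*} [Field F] [AddCommGroup M] [Module F M]
    (ρ : Representation F (G p)ᵐᵒᵖ M) : Representation F (B p)ᵐᵒᵖ M :=
  ρ.comp (MonoidHom.op (B p).subtype)

/-- The algebra endomorphism of `F[x, y]`, with `x = X 0` and `y = X 1`, given by the substitution
`x ↦ α x + β y`, `y ↦ γ x + δ y` for a matrix `(α β; γ δ)` in `G`. -/
def subst {p : ℕ} (F : Type*) [Field F] [CharP F p] (A : G p) :
    MvPolynomial (Fin 2) F →ₐ[F] MvPolynomial (Fin 2) F :=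
  MvPolynomial.aeval fun i : Fin 2 =>
    ∑ j, MvPolynomial.C (ZMod.castHom (dvd_refl p) F (A.1 i j)) * MvPolynomial.X j

theorem subst_X {p : ℕ} (F : Type*) [Field F] [CharP F p] (A : G p) (i : Fin 2) :
    subst F A (MvPolynomial.X i) =
      ∑ j, MvPolynomial.C (ZMod.castHom (dvd_refl p) F (A.1 i j)) * MvPolynomial.X j := by
  simp only [subst, MvPolynomial.aeval_X]

theorem subst_one {p : ℕ} (F : Type*) [Field F] [CharP F p] :
    subst F (1 : G p) = AlgHom.id F _ := by
  apply MvPolynomial.algHom_ext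
  intro i
  rw [subst_X]
  fin_cases i <;> simp [Fin.sum_univ_two]

theorem subst_mul {p : ℕ} (F : Type*) [Field F] [CharP F p] (A A' : G p) :
    subst F (A * A') = (subst F A').comp (subst F A) := by
  apply MvPolynomial.algHom_ext
  intro i
  have hC : ∀ (D : G p) (c : F), subst F D (MvPolynomial.C c) = MvPolynomial.C c :=
    fun D c => MvPolynomial.algHom_C _ _
  rw [AlgHom.comp_apply, subst_X, subst_X]
  simp only [Fin.sum_univ_two, map_add, map_mul, hC, subst_X,
    Matrix.SpecialLinearGroup.coe_mul, Matrix.mul_apply]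
  ring

theorem subst_isHomogeneous {p : ℕ} (F : Type*) [Field F] [CharP F p] (A : G p) {n : ℕ}
    {f : MvPolynomial (Fin 2) F} (hf : f.IsHomogeneous n) : (subst F A f).IsHomogeneous n := by
  have := hf.aeval (S := F) (n := 1) (fun i : Fin 2 =>
    ∑ j, MvPolynomial.C (ZMod.castHom (dvd_refl p) F (A.1 i j)) * MvPolynomial.X j) (fun i =>
      MvPolynomial.IsHomogeneous.sum _ _ _ fun j _ => by
        simpa only [zero_add] using (MvPolynomial.isHomogeneous_C (Fin 2) _).mul
          (MvPolynomial.isHomogeneous_X F j))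
  rwa [one_mul] at this

/-- The right action of `G` on `F[x, y]` by substitution,
`x^i y^j · (α β; γ δ) = (α x + β y)^i (γ x + δ y)^j`. -/
def polyRep (p : ℕ) (F : Type*) [Field F] [CharP F p] :
    Representation F (G p)ᵐᵒᵖ (MvPolynomial (Fin 2) F) where
  toFun A := (subst F A.unop).toLinearMap
  map_one' := by
    rw [unop_one, subst_one]
    rfl
  map_mul' A A' := by
    rw [unop_mul, subst_mul]
    rfl

/-- The space of homogeneous polynomials of degree `t - 1`, that is, the span of
`x^(t-1), x^(t-2) y, …, y^(t-1)`, as a right `F[G]`-submodule of `F[x, y]`. -/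
def VSub (p : ℕ) (F : Type*) [Field F] [CharP F p] (t : ℕ) :
    Subrepresentation (polyRep p F) where
  toSubmodule := MvPolynomial.homogeneousSubmodule (Fin 2) F (t - 1)
  apply_mem_toSubmodule A _ hf := subst_isHomogeneous F A.unop hf

/-- The module `V_t`. -/
def V (p : ℕ) (F : Type*) [Field F] [CharP F p] (t : ℕ) :
    Representation F (G p)ᵐᵒᵖ (VSub p F t).toSubmodule :=
  (VSub p F t).toRepresentation

/-- `σ` is a projective cover of `ρ`: it is projective and has an epimorphism onto `ρ` whose
kernel is superfluous. -/
def IsProjectiveCover {F H P M : Type*} [Field F] [Group H] [AddCommGroup P] [Module F P]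
    [AddCommGroup M] [Module F M] (σ : Representation F H P) (ρ : Representation F H M) : Prop :=
  Module.Projective (MonoidAlgebra F H) σ.asModule ∧
    ∃ π : σ.IntertwiningMap ρ, Function.Surjective π ∧
      ∀ N : Subrepresentation σ, N ⊔ π.ker = ⊤ → N = ⊤

/-- The subquotient `N₂ / (N₁ ∩ N₂)`, which is `N₂ / N₁` for `N₁ ≤ N₂`. -/
def subquotient {F H M : Type*} [Field F] [Group H] [AddCommGroup M] [Module F M]
    {ρ : Representation F H M} (N₁ N₂ : Subrepresentation ρ) :
    Representation F H (N₂.toSubmodule ⧸ N₁.toSubmodule.comap N₂.toSubmodule.subtype) :=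
  N₂.toRepresentation.quotient (N₁.toSubmodule.comap N₂.toSubmodule.subtype)
    fun h _ hv => N₁.apply_mem_toSubmodule h hv

/-- The module is the simple `F[B]`-module `S_a`: it has dimension one, `g` acts trivially and `λ`
acts as multiplication by `ζ ^ a`. -/
def IsS {p : ℕ} {F M : Type*} [Field F] [CharP F p] [AddCommGroup M] [Module F M]
    (ζ : (ZMod p)ˣ) (a : ℤ) (ρ : Representation F (B p)ᵐᵒᵖ M) : Prop :=
  Module.finrank F M = 1 ∧ (∀ v, ρ (op (g p)) v = v) ∧
    ∀ v, ρ (op (lam ζ)) v = (ZMod.castHom (dvd_refl p) F (ζ : ZMod p)) ^ a • v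

/-- A module is uniserial if its submodules form a chain. -/
def IsUniserial {F H M : Type*} [Field F] [Group H] [AddCommGroup M] [Module F M]
    (ρ : Representation F H M) : Prop :=
  ∀ N₁ N₂ : Subrepresentation ρ, N₁ ≤ N₂ ∨ N₂ ≤ N₁

/-- The module is `U_{a,b}`: it is uniserial of dimension `b`, and it has a composition series
with factors `S_a, S_{a+2}, …, S_{a+2(b-1)}`, from the bottom to the top. -/
def IsU {p : ℕ} {F M : Type*} [Field F] [CharP F p] [AddCommGroup M] [Module F M]
    (ζ : (ZMod p)ˣ) (a : ℤ) (b : ℕ) (ρ : Representation F (B p)ᵐᵒᵖ M) : Prop :=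
  IsUniserial ρ ∧ Module.finrank F M = b ∧
    ∃ W : Fin (b + 1) → Subrepresentation ρ, W 0 = ⊥ ∧ W (Fin.last b) = ⊤ ∧
      ∀ i : Fin b, W i.castSucc ≤ W i.succ ∧
        IsS ζ (a + 2 * (i : ℕ)) (subquotient (W i.castSucc) (W i.succ))

end

end SL2Rep

namespace SL2Rep

noncomputable section

/-! ### Projective modules and projective covers -/

section General

variable {F H K P M N : Type*} [Field F] [Group H] [Group K]
  [AddCommGroup P] [Module F P] [AddCommGroup M] [Module F M] [AddCommGroup N] [Module F N]

/-! The argument finds the top of the restriction of `P = P_{V_t}` to `B`, and then uses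
projectivity together with a dimension bound.

Let `U = ⟨g⟩`. A `U`-invariant linear form on `P` is, by Frobenius reciprocity (`exists_frobenius`),
a `G`-map from `P` to the functions on `G/U = 𝔽_p² ∖ {0}`. The scalars `𝔽_pˣ` split these functions
into homogeneous parts `funSub d` with `0 ≤ d ≤ p - 2`, and there is an exact sequence `0 → V_{d+1}
→ funSub d → V_{p-d} → 0` (`exists_evalMap_eq`): evaluation of polynomials, followed by `f ↦ ∑ f(w)
(w₀ y - w₁ x)^(p-d-1)`. Since `P` covers `V_t`, `Hom(P, V_s)` vanishes for `s ≠ t` and is the line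
spanned by `π` for `s = t`. Only `d = t - 1` (when `t < p`) and `d = p - t` (when `t ≥ 2`)
contribute, each with one form (`mem_of_g_invariant`). On the form of degree `d`, `B` acts through
`α ^ d`, which yields the maps onto `S_{t-1}` and `S_{p-t}`.

As `(g - 1)^p = 0`, the dimension of `P` is at most `p` times the dimension of the space of
invariant forms (`finrank_le_of_g_invariant`). Conversely, maps out of the restriction lift along
epimorphisms of `B`-modules (`exists_lift_comp`), and `U_{a,p}` has top `S_a` with superfluous
kernel because `ζ^(p-1) = 1` (`IsU.exists_top`). So the map onto the one or two characters lifts to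
an epimorphism onto the `U`'s, and the bound makes it an isomorphism (`nonempty_equiv_of_lift`).

For existence, the projective cover is a minimal projective submodule of the group algebra mapping
onto `V_t` (`exists_isProjectiveCover`), and `U_{a,p}` is realised on polynomials of degree less
than `p` under affine substitutions (`exists_isU`). -/

theorem map_apply_rep {σ : Representation F H P} {ρ : Representation F H M}
    (f : σ.IntertwiningMap ρ) (h : H) (v : P) : f (σ h v) = ρ h (f v) :=
  Representation.IntertwiningMap.isIntertwining σ ρ f h v

/-- Turns superfluousness of `π.ker` into a usable test: a subrepresentation with the same image as
the whole module is everything. -/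
theorem sup_ker_eq_top_iff {σ : Representation F H P} {ρ : Representation F H M}
    (π : σ.IntertwiningMap ρ) (X : Subrepresentation σ) :
    X ⊔ π.ker = ⊤ ↔ ∀ v, ∃ x ∈ X, π x = π v := by
  constructor
  · intro h v
    have hv : v ∈ (X ⊔ π.ker).toSubmodule := by rw [h]; trivial
    obtain ⟨x, hx, k, hk, rfl⟩ := Submodule.mem_sup.mp hv
    refine ⟨x, hx, ?_⟩
    have hk' : π k = 0 := hk
    rw [map_add, hk', add_zero]
  · intro h
    refine top_unique fun v _ => ?_
    obtain ⟨x, hx, hxv⟩ := h v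
    refine Submodule.mem_sup.mpr ⟨x, hx, v - x, ?_, by abel⟩
    change π (v - x) = 0
    rw [map_sub, hxv, sub_self]

theorem exists_lift {σ : Representation F H P}
    (hσ : Module.Projective (MonoidAlgebra F H) σ.asModule)
    {ρ : Representation F H M} {τ : Representation F H N} (f : ρ.IntertwiningMap τ)
    (hf : Function.Surjective f) (h : σ.IntertwiningMap τ) :
    ∃ k : σ.IntertwiningMap ρ, ∀ v, f (k v) = h v := by
  obtain ⟨k, hk⟩ := Module.projective_lifting_property
    (Representation.IntertwiningMap.equivLinearMapAsModule ρ τ f)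
    (Representation.IntertwiningMap.equivLinearMapAsModule σ τ h) hf
  exact ⟨(Representation.IntertwiningMap.equivLinearMapAsModule σ ρ).symm k,
    fun v => LinearMap.congr_fun hk v⟩

/-- Functions in the coinduced module are free on coset representatives. Writing `x = φ (κ x) * r
x`, a preimage may be chosen arbitrarily at `r x` and is then forced at `x`. -/
theorem coindMap_surjective {φ : K →* H} (hφ : Function.Injective φ)
    {ρ : Representation F K M} {τ : Representation F K N} (f : ρ.IntertwiningMap τ)
    (hf : Function.Surjective f) : Function.Surjective (Representation.coindMap φ f) := by
  intro y
  let s := QuotientGroup.rightRel φ.range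
  let r : H → H := fun x => (Quotient.mk s x).out
  have hr : ∀ x, ∃ k, φ k * r x = x := by
    intro x
    have h1 : s (r x) x := Quotient.exact (Quotient.out_eq (Quotient.mk s x))
    obtain ⟨k, hk⟩ := QuotientGroup.rightRel_apply.mp h1
    exact ⟨k, by rw [hk]; group⟩
  choose κ hκ using hr
  choose sec hsec using hf
  have hrφ : ∀ k x, r (φ k * x) = r x := by
    intro k x
    have : Quotient.mk s (φ k * x) = Quotient.mk s x :=
      Quotient.sound (QuotientGroup.rightRel_apply.mpr ⟨k⁻¹, by simp⟩)
    simp only [r, this]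
  have hκφ : ∀ k x, κ (φ k * x) = k * κ x := by
    intro k x
    apply hφ
    have h1 := hκ (φ k * x)
    rw [hrφ] at h1
    have h2 : φ k * (φ (κ x) * r x) = φ k * x := by rw [hκ]
    rw [← mul_assoc] at h2
    rw [map_mul]
    exact mul_right_cancel (h1.trans h2.symm)
  refine ⟨⟨fun x => ρ (κ x) (sec (y.1 (r x))), ?_⟩, ?_⟩
  · intro k x
    simp only [hrφ, hκφ, map_mul, Module.End.mul_apply]
  · apply Subtype.ext
    funext x
    rw [Representation.coindMap_coe_apply_apply]
    change f (ρ (κ x) (sec (y.1 (r x)))) = y.1 x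
    rw [map_apply_rep, hsec, ← y.2, hκ]

/-- The restriction of a projective representation along an injective homomorphism has the
lifting property. -/
theorem exists_lift_comp {φ : K →* H} (hφ : Function.Injective φ) {σ : Representation F H P}
    (hσ : Module.Projective (MonoidAlgebra F H) σ.asModule)
    {ρ : Representation F K M} {τ : Representation F K N} (f : ρ.IntertwiningMap τ)
    (hf : Function.Surjective f)
    (h : Representation.IntertwiningMap (σ.comp φ : Representation F K P) τ) :
    ∃ k : Representation.IntertwiningMap (σ.comp φ : Representation F K P) ρ,
      ∀ v, f (k v) = h v := by
  -- Adjunction between restriction and coinduction: transpose `h`, lift it over `H`, then transpose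
  -- back by evaluating at `1`.
  let h' : σ.IntertwiningMap (Representation.coind φ τ) :=
    { toFun := fun v => ⟨fun x => h (σ x v), fun k x => by
        have := map_apply_rep h k (σ x v)
        change h (σ (φ k * x) v) = _
        rwa [map_mul]⟩
      map_add' := fun a b => Subtype.ext <| by funext x; simp
      map_smul' := fun a b => Subtype.ext <| by funext x; simp
      isIntertwining' := fun y => by
        ext v x
        change h (σ x (σ y v)) = h (σ (x * y) v)
        rw [map_mul]; rfl }
  obtain ⟨k, hk⟩ := exists_lift hσ (Representation.coindMap φ f) (coindMap_surjective hφ f hf) h'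
  refine ⟨{ toFun := fun v => (k v).1 1
            map_add' := fun a b => by simp
            map_smul' := fun a b => by simp
            isIntertwining' := fun y => ?_ }, fun v => ?_⟩
  · ext v
    have h1 := map_apply_rep k (φ y) v
    change (k (σ (φ y) v)).1 1 = ρ y ((k v).1 1)
    rw [h1, ← (k v).2 y 1]
    change (k v).1 (1 * φ y) = _
    rw [one_mul, mul_one]
  · have h1 := congrFun (congrArg Subtype.val (hk v)) 1
    rw [Representation.coindMap_coe_apply_apply] at h1
    refine h1.trans ?_
    change h (σ 1 v) = h v
    rw [map_one]; rfl

/-- A projective module of finite length that maps onto `S` contains a projective cover of `S`. -/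
theorem exists_projective_submodule {R X S : Type*} [Ring R] [AddCommGroup X] [Module R X]
    [AddCommGroup S] [Module R S] [IsArtinian R X] [IsNoetherian R X] [Module.Projective R X]
    (f : X →ₗ[R] S) (hf : Function.Surjective f) :
    ∃ Q : Submodule R X, Module.Projective R Q ∧ Function.Surjective (f.domRestrict Q) ∧
      ∀ Y : Submodule R Q, (∀ q, ∃ y ∈ Y, f.domRestrict Q y = f.domRestrict Q q) → Y = ⊤ := by
  let C : Set (Submodule R X) :=
    {Q | Module.Projective R Q ∧ Function.Surjective (f.domRestrict Q)}
  have hC : C.Nonempty := ⟨⊤, Module.Projective.of_equiv Submodule.topEquiv.symm,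
    fun s => by obtain ⟨x, rfl⟩ := hf s; exact ⟨⟨x, trivial⟩, rfl⟩⟩
  -- A minimal projective submodule mapping onto `S` will have superfluous kernel.
  obtain ⟨Q, ⟨hQp, hQs⟩, hmin⟩ :=
    (IsWellFounded.wf (r := ((· < ·) : Submodule R X → Submodule R X → Prop))).has_min C hC
  refine ⟨Q, hQp, hQs, fun Y hY => ?_⟩
  set g := f.domRestrict Q with hg
  -- Lifting `g` through `Y` gives an endomorphism `ψ` of `Q` over `S` with image in `Y`.
  obtain ⟨φ, hφ⟩ := Module.projective_lifting_property (g ∘ₗ Y.subtype) g (fun s => by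
    obtain ⟨q, rfl⟩ := hQs s
    obtain ⟨y, hy, hyq⟩ := hY q
    exact ⟨⟨y, hy⟩, hyq⟩)
  let ψ : Module.End R Q := Y.subtype ∘ₗ φ
  have hψ : ∀ q, g (ψ q) = g q := fun q => LinearMap.congr_fun hφ q
  have hψk : ∀ k q, g ((ψ ^ k) q) = g q := by
    intro k
    induction k with
    | zero => intro q; rfl
    | succ k ih => intro q; rw [pow_succ, Module.End.mul_apply, ih, hψ]
  -- Fitting decomposition: the range of `ψ ^ k` is a direct summand, hence projective, and still
  -- maps onto `S`. Minimality makes it all of `Q`; `k ≥ 1` then puts `Q` inside `Y`.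
  obtain ⟨k, hk1, hk⟩ := ((Filter.eventually_ge_atTop 1).and
    ψ.eventually_isCompl_ker_pow_range_pow).exists
  have hproj : Module.Projective R (LinearMap.range (ψ ^ k)) :=
    Module.Projective.of_split (LinearMap.range (ψ ^ k)).subtype
      (Submodule.projectionOnto _ _ hk.symm) (by
        ext x : 1
        exact Submodule.projectionOnto_apply_left hk.symm x)
  let Q' : Submodule R X := (LinearMap.range (ψ ^ k)).map Q.subtype
  have hQ' : Q' ∈ C := by
    refine ⟨Module.Projective.of_equiv
      (Submodule.equivMapOfInjective Q.subtype Q.subtype_injective _), fun s => ?_⟩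
    obtain ⟨q, rfl⟩ := hQs s
    exact ⟨⟨(ψ ^ k) q, Submodule.mem_map_of_mem ⟨q, rfl⟩⟩, hψk k q⟩
  have hle : Q' ≤ Q := Submodule.map_subtype_le _ _
  have hQQ : Q' = Q := by
    by_contra hne
    exact hmin Q' hQ' (lt_of_le_of_ne hle hne)
  refine top_unique fun q _ => ?_
  have hq : (q : X) ∈ Q' := hQQ.ge q.2
  obtain ⟨q', ⟨z, hz'⟩, hz⟩ := hq
  have hqz : q = (ψ ^ k) z := (Subtype.ext hz.symm).trans hz'.symm
  obtain ⟨j, hj⟩ := Nat.exists_eq_add_of_le hk1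
  rw [hqz, hj, pow_add, pow_one, Module.End.mul_apply]
  exact (φ _).2

/-- A cyclic representation of a finite group has a projective cover. -/
theorem exists_isProjectiveCover {F : Type u} {H : Type} {M : Type*} [Field F] [Group H] [Finite H]
    [AddCommGroup M] [Module F M] (ρ : Representation F H M) (v : M)
    (hv : ∀ X : Subrepresentation ρ, v ∈ X → X = ⊤) :
    ∃ (P : Type u) (_ : AddCommGroup P) (_ : Module F P) (σ : Representation F H P),
      IsProjectiveCover σ ρ := by
  have : Module.Finite F (MonoidAlgebra F H) :=
    Module.Finite.of_basis (MonoidAlgebra.basis H F)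
  have : IsArtinian (MonoidAlgebra F H) (MonoidAlgebra F H) :=
    isArtinian_of_tower F inferInstance
  have : IsNoetherian (MonoidAlgebra F H) (MonoidAlgebra F H) :=
    isNoetherian_of_tower F inferInstance
  let f : MonoidAlgebra F H →ₗ[MonoidAlgebra F H] ρ.asModule :=
    LinearMap.toSpanSingleton _ _ (ρ.asModuleEquiv.symm v)
  have hf : Function.Surjective f := by
    rw [← LinearMap.range_eq_top]
    have h1 := hv (Subrepresentation.ofSubmodule' (LinearMap.range f)) ⟨1, one_smul _ _⟩
    refine top_unique fun x _ => ?_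
    have : x ∈ Subrepresentation.ofSubmodule' (LinearMap.range f) := by rw [h1]; trivial
    exact this
  obtain ⟨Q, hQp, hQs, hQ⟩ := exists_projective_submodule f hf
  let σ : Representation F H Q := Representation.ofModule' Q
  have hσ : ∀ h (q : Q), σ h q = MonoidAlgebra.single h (1 : F) • q := fun h q => by
    simp [σ, Representation.ofModule']
  let e : σ.asModule ≃ₗ[MonoidAlgebra F H] Q :=
    { σ.asModuleEquiv.toAddEquiv with
      map_smul' := fun r q => by
        change σ.asModuleEquiv (r • q) = r • σ.asModuleEquiv q
        induction r using MonoidAlgebra.induction_linear with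
        | zero => simp
        | add x y hx hy => rw [add_smul, map_add, hx, hy, add_smul]
        | single h a =>
          rw [Representation.asModuleEquiv_map_smul, Representation.asAlgebraHom_single,
            LinearMap.smul_apply, hσ, ← smul_assoc, MonoidAlgebra.smul_single, smul_eq_mul,
            mul_one] }
  let π := (Representation.IntertwiningMap.equivLinearMapAsModule σ ρ).symm
    ((f.domRestrict Q) ∘ₗ e.toLinearMap)
  refine ⟨Q, inferInstance, inferInstance, σ, Module.Projective.of_equiv e.symm, π, hQs, ?_⟩
  intro X hX
  rw [sup_ker_eq_top_iff] at hX
  have h1 := hQ (X.asSubmodule.map e.toLinearMap) (fun q => by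
    obtain ⟨x, hx, hxq⟩ := hX q
    exact ⟨x, ⟨x, hx, rfl⟩, hxq⟩)
  refine top_unique fun q _ => ?_
  have hq : q ∈ X.asSubmodule.map e.toLinearMap := by rw [h1]; trivial
  obtain ⟨x, hx, rfl⟩ := hq
  exact hx

/-- A representation with a superfluous subrepresentation whose quotient is generated by any
nonzero vector is cyclic, hence finite-dimensional if the group is finite. -/
theorem finite_of_superfluous [Finite H] {σ : Representation F H P} {ρ : Representation F H M}
    (π : σ.IntertwiningMap ρ) (hs : ∀ X : Subrepresentation σ, X ⊔ π.ker = ⊤ → X = ⊤)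
    (v : P) (hv : ∀ X : Subrepresentation ρ, π v ∈ X → X = ⊤) : Module.Finite F P := by
  -- The span of the orbit of `v`; it maps onto the target, so superfluousness makes it everything.
  let X : Subrepresentation σ :=
    { toSubmodule := Submodule.span F (Set.range fun h => σ h v)
      apply_mem_toSubmodule := fun h x hx => by
        have h2 : Submodule.span F (Set.range fun h => σ h v) ≤
            (Submodule.span F (Set.range fun h => σ h v)).comap (σ h) := by
          rw [Submodule.span_le]
          rintro _ ⟨k, rfl⟩
          refine Submodule.subset_span ⟨h * k, ?_⟩
          simp only [map_mul, Module.End.mul_apply]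
        exact h2 hx }
  let Y : Subrepresentation ρ :=
    { toSubmodule := X.toSubmodule.map π.toLinearMap
      apply_mem_toSubmodule := by
        rintro h _ ⟨x, hx, rfl⟩
        exact ⟨σ h x, X.apply_mem_toSubmodule h hx, map_apply_rep π h x⟩ }
  have hY : Y = ⊤ := hv Y ⟨v, Submodule.subset_span ⟨1, by simp⟩, rfl⟩
  have hX : X = ⊤ := hs X <| (sup_ker_eq_top_iff π X).mpr fun w => by
    have : π w ∈ Y := by rw [hY]; trivial
    exact this
  refine ⟨?_⟩
  have : X.toSubmodule = ⊤ := by rw [hX]; rfl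
  rw [← this]
  exact Submodule.fg_span (Set.finite_range _)

end General

/-! ### The uniserial modules `U_{a,p}` -/

section Uniserial

open Polynomial

variable {p : ℕ} {F : Type*} [Field F]

theorem natDegree_comp_le_of_natDegree_le_one {f q : F[X]} {n : ℕ} (hf : f.natDegree ≤ n)
    (hq : q.natDegree ≤ 1) : (f.comp q).natDegree ≤ n :=
  natDegree_comp_le.trans ((Nat.mul_le_mul hf hq).trans (mul_one n).le)

theorem comp_mem_degreeLT {f q : F[X]} {n : ℕ} (hf : f ∈ degreeLT F n) (hq : q.natDegree ≤ 1) :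
    f.comp q ∈ degreeLT F n := by
  rcases n with _ | n
  · have : f = 0 := by
      rw [mem_degreeLT] at hf
      simpa [Nat.WithBot.lt_zero_iff] using hf
    simp [this]
  · rw [degreeLT_succ_eq_degreeLE, mem_degreeLE] at hf ⊢
    exact natDegree_le_iff_degree_le.mp
      (natDegree_comp_le_of_natDegree_le_one (natDegree_le_iff_degree_le.mpr hf) hq)

theorem mem_degreeLT_succ_iff {f : F[X]} {n : ℕ} : f ∈ degreeLT F (n + 1) ↔ f.natDegree ≤ n := by
  rw [degreeLT_succ_eq_degreeLE, mem_degreeLE, natDegree_le_iff_degree_le]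

theorem coeff_comp_linear {f q : F[X]} {n : ℕ} (hf : f.natDegree ≤ n) (hq : q.natDegree ≤ 1) :
    (f.comp q).coeff n = f.coeff n * q.coeff 1 ^ n := by
  conv_lhs => rw [f.as_sum_range' (n + 1) (Nat.lt_succ_of_le hf)]
  rw [← Polynomial.coe_compRingHom_apply, map_sum, finsetSum_coeff, Finset.sum_range_succ,
    Finset.sum_eq_zero]
  · rw [zero_add, coe_compRingHom_apply, monomial_comp, coeff_C_mul]
    have := coeff_pow_of_natDegree_le (m := n) hq
    rw [mul_one] at this
    rw [this]
  · intro k hk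
    rw [coe_compRingHom_apply, monomial_comp, coeff_C_mul,
      coeff_eq_zero_of_natDegree_lt (p := q ^ k), mul_zero]
    refine lt_of_le_of_lt (natDegree_pow_le_of_le k hq) ?_
    simpa using hk

/-- By Taylor expansion at `1`. The extra term `(n + 1) * f.coeff (n + 1)` is the leading
coefficient of the difference `f (X + 1) - f`, nonzero as long as the degree stays below `p`. -/
theorem coeff_comp_X_add_one {f : F[X]} {n : ℕ} (hf : f.natDegree ≤ n + 1) :
    (f.comp (X + 1)).coeff n = f.coeff n + (n + 1) * f.coeff (n + 1) := by
  have h1 : f.comp (X + 1) = taylor 1 f := by rw [taylor_apply, C_1]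
  rw [h1, taylor_coeff, eval_eq_sum_range' (n := 2)]
  · simp [Finset.sum_range_succ, hasseDeriv_coeff, add_comm 1 n]
  · refine lt_of_le_of_lt (natDegree_hasseDeriv_le f n) ?_
    omega

/-- A subspace of `F[X]` that is stable under the shift `X ↦ X + 1` and contains a polynomial of
degree `n < p` contains all polynomials of degree at most `n`. -/
theorem mem_of_natDegree_le_of_shift [CharP F p] (S : Submodule F F[X])
    (hS : ∀ f ∈ S, f.comp (X + 1) ∈ S) {n : ℕ} (hn : n < p) {f : F[X]} (hf : f ∈ S)
    (hfn : f.natDegree ≤ n) (hfc : f.coeff n ≠ 0) {h : F[X]} (hh : h.natDegree ≤ n) : h ∈ S := by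
  induction n generalizing f h with
  | zero =>
    have : h = (h.coeff 0 / f.coeff 0) • f := by
      rw [eq_C_of_natDegree_le_zero hfn, eq_C_of_natDegree_le_zero hh, smul_C]
      simp only [coeff_C_zero, smul_eq_mul]
      rw [div_mul_cancel₀ _ hfc]
    rw [this]
    exact S.smul_mem _ hf
  | succ n ih =>
    have hX : (X + 1 : F[X]).natDegree ≤ 1 := (natDegree_X_add_C (1 : F)).le
    -- The difference operator lowers the degree by exactly one, which feeds the induction.
    have hD : f.comp (X + 1) - f ∈ S := S.sub_mem (hS f hf) hf
    have hDn : (f.comp (X + 1) - f).natDegree ≤ n := by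
      rw [natDegree_le_iff_coeff_eq_zero]
      intro N hN
      rw [coeff_sub]
      rcases (Nat.succ_le_of_lt hN).eq_or_lt with rfl | hN'
      · rw [coeff_comp_linear hfn hX]
        simp [coeff_one]
      · rw [coeff_eq_zero_of_natDegree_lt (lt_of_le_of_lt hfn hN'),
          coeff_eq_zero_of_natDegree_lt
            (lt_of_le_of_lt (natDegree_comp_le_of_natDegree_le_one hfn hX) hN'), sub_zero]
    have hDc : (f.comp (X + 1) - f).coeff n ≠ 0 := by
      rw [coeff_sub, coeff_comp_X_add_one hfn, add_sub_cancel_left]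
      refine mul_ne_zero ?_ hfc
      intro h0
      have h1 : ((n + 1 : ℕ) : F) = 0 := by exact_mod_cast h0
      rw [CharP.cast_eq_zero_iff F p] at h1
      exact absurd (Nat.le_of_dvd n.succ_pos h1) (not_le.mpr hn)
    have h1 : h - (h.coeff (n + 1) / f.coeff (n + 1)) • f ∈ S := by
      refine ih (Nat.lt_of_succ_lt hn) hD hDn hDc ?_
      rw [natDegree_le_iff_coeff_eq_zero]
      intro N hN
      rw [coeff_sub, coeff_smul, smul_eq_mul]
      rcases (Nat.succ_le_of_lt hN).eq_or_lt with rfl | hN'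
      · rw [Nat.succ_eq_add_one, div_mul_cancel₀ _ hfc, sub_self]
      · rw [coeff_eq_zero_of_natDegree_lt (lt_of_le_of_lt hfn hN'),
          coeff_eq_zero_of_natDegree_lt (lt_of_le_of_lt hh hN'), mul_zero, sub_zero]
    have h2 := S.add_mem h1 (S.smul_mem (h.coeff (n + 1) / f.coeff (n + 1)) hf)
    rwa [sub_add_cancel] at h2

/-! ### The affine action of `B` on polynomials -/

variable [CharP F p]

/-- The affine polynomial `α² X + α β` attached to `(α β; 0 α⁻¹)`. -/
def affine (F : Type*) [Field F] [CharP F p] (b : B p) : F[X] :=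
  C (ZMod.castHom (dvd_refl p) F (b.1.1 0 0 ^ 2)) * X +
    C (ZMod.castHom (dvd_refl p) F (b.1.1 0 0 * b.1.1 0 1))

theorem natDegree_affine_le (b : B p) : (affine F b).natDegree ≤ 1 :=
  natDegree_linear_le

theorem coeff_affine_one (b : B p) :
    (affine F b).coeff 1 = ZMod.castHom (dvd_refl p) F (b.1.1 0 0) ^ 2 := by
  rw [affine, coeff_add, coeff_C_mul, coeff_X_one, coeff_C, if_neg one_ne_zero, add_zero, mul_one,
    map_pow]

theorem B_apply_one_zero (b : B p) : b.1.1 1 0 = 0 := b.2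

theorem B_apply_mul (b : B p) : b.1.1 0 0 * b.1.1 1 1 = 1 := by
  have := b.1.2
  rwa [Matrix.det_fin_two, B_apply_one_zero, mul_zero, sub_zero] at this

theorem B_mul_apply_zero_zero (b b' : B p) :
    (b * b').1.1 0 0 = b.1.1 0 0 * b'.1.1 0 0 := by
  simp [Matrix.mul_apply, Fin.sum_univ_two, B_apply_one_zero]

theorem affine_mul (b b' : B p) : affine F (b * b') = (affine F b).comp (affine F b') := by
  have h1 : (b * b').1.1 0 1 = b.1.1 0 0 * b'.1.1 0 1 + b.1.1 0 1 * b'.1.1 1 1 := by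
    simp [Matrix.mul_apply, Fin.sum_univ_two]
  have h2 : (b * b').1.1 0 0 * (b * b').1.1 0 1 =
      b.1.1 0 0 ^ 2 * (b'.1.1 0 0 * b'.1.1 0 1) + b.1.1 0 0 * b.1.1 0 1 := by
    rw [h1, B_mul_apply_zero_zero]
    linear_combination (b.1.1 0 0 * b.1.1 0 1) * B_apply_mul b'
  rw [affine, h2, B_mul_apply_zero_zero]
  simp only [affine, add_comp, mul_comp, pow_comp, C_comp, X_comp, map_mul, map_add,
    map_pow]
  ring

/-- The right action of `B` on `F[X]` in which `(α β; 0 α⁻¹)` sends `f` to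
`α ^ a f (α² X + α β)`. -/
def affineRep (p : ℕ) (F : Type*) [Field F] [CharP F p] (a : ℤ) :
    Representation F (B p)ᵐᵒᵖ F[X] where
  toFun b :=
    { toFun := fun f => ZMod.castHom (dvd_refl p) F (b.unop.1.1 0 0) ^ a • f.comp (affine F b.unop)
      map_add' := fun f h => by rw [add_comp, smul_add]
      map_smul' := fun c f => by rw [smul_comp, smul_comm, RingHom.id_apply] }
  map_one' := by
    ext : 2
    simp [affine]
  map_mul' b b' := by
    refine LinearMap.ext fun f => ?_
    simp only [unop_mul, LinearMap.coe_mk, AddHom.coe_mk, Module.End.mul_apply, affine_mul,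
      B_mul_apply_zero_zero, map_mul, mul_zpow, smul_comp, comp_assoc, smul_smul]
    rw [mul_comm]

theorem affineRep_apply (a : ℤ) (b : B p) (f : F[X]) : affineRep p F a (op b) f =
    ZMod.castHom (dvd_refl p) F (b.1.1 0 0) ^ a • f.comp (affine F b) := rfl

theorem affineRep_apply_g (a : ℤ) (f : F[X]) : affineRep p F a (op (g p)) f = f.comp (X + 1) := by
  simp [affineRep_apply, g, affine]

/-- The polynomials of degree less than `n`, as a submodule for the action of `B`. -/
def affineSub (p : ℕ) (F : Type*) [Field F] [CharP F p] (a : ℤ) (n : ℕ) :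
    Subrepresentation (affineRep p F a) where
  toSubmodule := degreeLT F n
  apply_mem_toSubmodule b _ hf :=
    (degreeLT F n).smul_mem _ (comp_mem_degreeLT hf (natDegree_affine_le b.unop))

/-- Since `g` acts as the shift, a submodule containing a polynomial of degree `n` contains all
those of degree at most `n`. Submodules are thus ordered by the degrees that occur. -/
theorem affineSub_isUniserial (a : ℤ) :
    IsUniserial (affineSub p F a p).toRepresentation := by
  intro N₁ N₂
  have key : ∀ (N : Subrepresentation (affineSub p F a p).toRepresentation)
      (f h : (affineSub p F a p).toSubmodule), f ∈ N → (f : F[X]) ≠ 0 →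
      (h : F[X]).natDegree ≤ (f : F[X]).natDegree → h ∈ N := by
    intro N f h hf hf0 hh
    have hlt : (f : F[X]).natDegree < p := by
      rw [natDegree_lt_iff_degree_lt hf0]
      exact mem_degreeLT.mp f.2
    have hmem : (h : F[X]) ∈ N.toSubmodule.map (affineSub p F a p).toSubmodule.subtype := by
      refine mem_of_natDegree_le_of_shift (f := (f : F[X])) _ ?_ hlt
        (Submodule.mem_map_of_mem hf) le_rfl (leadingCoeff_ne_zero.mpr hf0) hh
      rintro _ ⟨y, hy, rfl⟩
      refine ⟨_, N.apply_mem_toSubmodule (op (g p)) hy, ?_⟩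
      exact affineRep_apply_g a _
    obtain ⟨y, hy, hyh⟩ := hmem
    have : y = h := Subtype.ext hyh
    exact this ▸ hy
  by_contra hcon
  rw [not_or] at hcon
  obtain ⟨f, hf₁, hf₂⟩ := Set.not_subset.mp hcon.1
  obtain ⟨h, hh₁, hh₂⟩ := Set.not_subset.mp hcon.2
  have hf0 : (f : F[X]) ≠ 0 := fun h0 => hf₂ (by
    have : f = 0 := Subtype.ext h0
    rw [this]; exact N₂.toSubmodule.zero_mem)
  have hh0 : (h : F[X]) ≠ 0 := fun h0 => hh₂ (by
    have : h = 0 := Subtype.ext h0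
    rw [this]; exact N₁.toSubmodule.zero_mem)
  rcases le_total (h : F[X]).natDegree (f : F[X]).natDegree with hle | hle
  · exact hh₂ (key N₁ f h hf₁ hf0 hle)
  · exact hf₂ (key N₂ h f hh₁ hh0 hle)

/-- The filtration of the polynomials of degree less than `p` by degree. -/
def affineFiltration (p : ℕ) (F : Type*) [Field F] [CharP F p] (a : ℤ) (n : ℕ) :
    Subrepresentation (affineSub p F a p).toRepresentation where
  toSubmodule := (degreeLT F n).comap (affineSub p F a p).toSubmodule.subtype
  apply_mem_toSubmodule b _ hf := (affineSub p F a n).apply_mem_toSubmodule b hf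

theorem mem_affineFiltration {a : ℤ} {n : ℕ} {f : (affineSub p F a p).toSubmodule} :
    f ∈ (affineFiltration p F a n).toSubmodule ↔ (f : F[X]) ∈ degreeLT F n := Iff.rfl

theorem mem_degreeLT_iff_coeff_eq_zero {f : F[X]} {n : ℕ} (hf : f ∈ degreeLT F (n + 1)) :
    f ∈ degreeLT F n ↔ f.coeff n = 0 := by
  rw [mem_degreeLT_succ_iff] at hf
  rw [mem_degreeLT]
  constructor
  · intro h
    exact coeff_eq_zero_of_degree_lt h
  · intro h
    rw [degree_lt_iff_coeff_zero]
    intro m hm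
    rcases hm.eq_or_lt with rfl | hm
    · exact h
    · exact coeff_eq_zero_of_natDegree_lt (lt_of_le_of_lt hf hm)

/-- Recognises `S_a` by an eigenform `c` on `N₂` with kernel `N₁`, so that no computation takes
place in the quotient. -/
theorem isS_subquotient {M : Type*} [AddCommGroup M] [Module F M]
    {ρ : Representation F (B p)ᵐᵒᵖ M} {ζ : (ZMod p)ˣ} {a : ℤ} {N₁ N₂ : Subrepresentation ρ}
    (c : N₂.toSubmodule →ₗ[F] F) (hsurj : Function.Surjective c)
    (hker : ∀ f : N₂.toSubmodule, c f = 0 ↔ (f : M) ∈ N₁.toSubmodule)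
    (hg : ∀ f, c (N₂.toRepresentation (op (g p)) f) = c f)
    (hlam : ∀ f, c (N₂.toRepresentation (op (lam ζ)) f) =
      ZMod.castHom (dvd_refl p) F (ζ : ZMod p) ^ a * c f) :
    IsS ζ a (subquotient N₁ N₂) := by
  have hker' : LinearMap.ker c = N₁.toSubmodule.comap N₂.toSubmodule.subtype := by
    ext f
    exact hker f
  have hmk : ∀ f h : N₂.toSubmodule, c f = c h →
      (Submodule.Quotient.mk f : N₂.toSubmodule ⧸ N₁.toSubmodule.comap N₂.toSubmodule.subtype) =
        Submodule.Quotient.mk h := by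
    intro f h hfh
    rw [Submodule.Quotient.eq, ← hker', LinearMap.mem_ker, map_sub, hfh, sub_self]
  refine ⟨?_, ?_, ?_⟩
  · rw [((Submodule.quotEquivOfEq _ _ hker').symm.trans
      (c.quotKerEquivOfSurjective hsurj)).finrank_eq, Module.finrank_self]
  · intro v
    obtain ⟨f, rfl⟩ := Submodule.Quotient.mk_surjective _ v
    exact hmk _ _ (hg f)
  · intro v
    obtain ⟨f, rfl⟩ := Submodule.Quotient.mk_surjective _ v
    refine (hmk _ (ZMod.castHom (dvd_refl p) F (ζ : ZMod p) ^ a • f) ?_).trans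
      (Submodule.Quotient.mk_smul _ _ _)
    rw [map_smul, smul_eq_mul, hlam]

/-- The coefficient of `X ^ i` is the eigenform: substituting `α² X + α β` multiplies the leading
term by `α ^ (2 i)`, on top of the twist `α ^ a`. -/
theorem affineFiltration_isS (ζ : (ZMod p)ˣ) (a : ℤ) {i : ℕ} (hi : i < p) :
    IsS ζ (a + 2 * (i : ℕ))
      (subquotient (affineFiltration p F a i) (affineFiltration p F a (i + 1))) := by
  let c : (affineFiltration p F a (i + 1)).toSubmodule →ₗ[F] F :=
    lcoeff F i ∘ₗ (affineSub p F a p).toSubmodule.subtype ∘ₗ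
      (affineFiltration p F a (i + 1)).toSubmodule.subtype
  have hc : ∀ f, c f = (f.1 : F[X]).coeff i := fun f => rfl
  have hact : ∀ (b : B p) (f : (affineFiltration p F a (i + 1)).toSubmodule),
      c ((affineFiltration p F a (i + 1)).toRepresentation (op b) f) =
        ZMod.castHom (dvd_refl p) F (b.1.1 0 0) ^ a *
          ((ZMod.castHom (dvd_refl p) F (b.1.1 0 0) ^ 2) ^ i * c f) := by
    intro b f
    rw [hc, hc]
    change (affineRep p F a (op b) (f.1 : F[X])).coeff i = _
    rw [affineRep_apply, coeff_smul, coeff_comp_linear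
      (mem_degreeLT_succ_iff.mp (mem_affineFiltration.mp f.2)) (natDegree_affine_le b),
      coeff_affine_one, smul_eq_mul, mul_comm (Polynomial.coeff _ _)]
  refine isS_subquotient c ?_ ?_ ?_ ?_
  · intro r
    have h1 : (C r * X ^ i).natDegree ≤ i := natDegree_C_mul_X_pow_le r i
    have h2 : (C r * X ^ i) ∈ degreeLT F p := by
      rw [mem_degreeLT]
      exact lt_of_le_of_lt (degree_le_of_natDegree_le h1) (by exact_mod_cast hi)
    refine ⟨⟨⟨C r * X ^ i, h2⟩, mem_degreeLT_succ_iff.mpr h1⟩, ?_⟩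
    rw [hc]
    simp
  · intro f
    rw [hc, mem_affineFiltration,
      mem_degreeLT_iff_coeff_eq_zero (mem_affineFiltration.mp f.2)]
  · intro f
    rw [hact]
    simp [g]
  · intro f
    have hz : ZMod.castHom (dvd_refl p) F (ζ : ZMod p) ≠ 0 := (ζ.isUnit.map _).ne_zero
    have hl : (lam ζ).1.1 0 0 = (ζ : ZMod p) := rfl
    rw [hact, hl, zpow_add₀ hz, _root_.zpow_mul, zpow_natCast, mul_assoc]
    norm_cast

theorem exists_isU {F : Type u} [Field F] [CharP F p] (ζ : (ZMod p)ˣ) (a : ℤ) :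
    ∃ (M : Type u) (_ : AddCommGroup M) (_ : Module F M)
      (ρ : Representation F (B p)ᵐᵒᵖ M), IsU ζ a p ρ := by
  refine ⟨_, inferInstance, inferInstance, (affineSub p F a p).toRepresentation,
    affineSub_isUniserial a, ?_, fun i => affineFiltration p F a i, ?_, ?_, ?_⟩
  · exact (degreeLTEquiv F p).finrank_eq.trans (Module.finrank_fin_fun F)
  · refine bot_unique fun f hf => ?_
    have h1 : (f : F[X]) ∈ degreeLT F 0 := hf
    rw [mem_degreeLT, Nat.cast_zero, Nat.WithBot.lt_zero_iff, degree_eq_bot] at h1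
    exact Subtype.ext h1
  · exact top_unique fun f _ => f.2
  · intro i
    exact ⟨fun f hf => degreeLT_mono (Nat.le_succ _) hf, affineFiltration_isS ζ a i.2⟩

end Uniserial

/-! ### The modules `V_t` are simple -/

section Simple

variable {p : ℕ} {F : Type*} [Field F]

/-- Dehomogenization `x ↦ X`, `y ↦ 1`. -/
def dehom (F : Type*) [Field F] : MvPolynomial (Fin 2) F →ₐ[F] Polynomial F :=
  MvPolynomial.aeval ![Polynomial.X, 1]

/-- Homogenization of degree `n`. -/
def homog (F : Type*) [Field F] (n : ℕ) : Polynomial F →ₗ[F] MvPolynomial (Fin 2) F :=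
  ∑ i ∈ Finset.range (n + 1), (Polynomial.lcoeff F i).smulRight
    (MvPolynomial.X 0 ^ i * MvPolynomial.X 1 ^ (n - i))

theorem homog_apply (n : ℕ) (h : Polynomial F) : homog F n h =
    ∑ i ∈ Finset.range (n + 1),
      h.coeff i • (MvPolynomial.X 0 ^ i * MvPolynomial.X 1 ^ (n - i) : MvPolynomial (Fin 2) F) := by
  simp [homog, LinearMap.sum_apply]

theorem dehom_X_zero : dehom F (MvPolynomial.X 0) = Polynomial.X := by simp [dehom]

theorem dehom_X_one : dehom F (MvPolynomial.X 1) = 1 := by simp [dehom]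

theorem dehom_homog {n : ℕ} {h : Polynomial F} (hh : h.natDegree ≤ n) :
    dehom F (homog F n h) = h := by
  conv_rhs => rw [h.as_sum_range_C_mul_X_pow' (Nat.lt_succ_of_le hh)]
  rw [homog_apply, map_sum]
  refine Finset.sum_congr rfl fun i _ => ?_
  rw [map_smul, map_mul, map_pow, map_pow, dehom_X_zero, dehom_X_one, one_pow, mul_one,
    Polynomial.smul_eq_C_mul]

theorem homog_isHomogeneous (n : ℕ) (h : Polynomial F) : (homog F n h).IsHomogeneous n := by
  rw [homog_apply]
  refine MvPolynomial.IsHomogeneous.sum _ _ _ fun i hi => ?_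
  rw [MvPolynomial.smul_eq_C_mul]
  have h1 := ((MvPolynomial.isHomogeneous_X F (0 : Fin 2)).pow i).mul
    ((MvPolynomial.isHomogeneous_X F (1 : Fin 2)).pow (n - i))
  have h2 := (MvPolynomial.isHomogeneous_C (Fin 2) (h.coeff i)).mul h1
  have h3 : 0 + (1 * i + 1 * (n - i)) = n := by
    have := Finset.mem_range.mp hi
    omega
  rwa [h3] at h2

theorem homog_dehom {n : ℕ} {f : MvPolynomial (Fin 2) F} (hf : f.IsHomogeneous n) :
    homog F n (dehom F f) = f := by
  conv_lhs => rw [f.as_sum]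
  conv_rhs => rw [f.as_sum]
  rw [map_sum, map_sum]
  refine Finset.sum_congr rfl fun s hs => ?_
  have hs' : s 0 + s 1 = n := by
    have := hf (MvPolynomial.mem_support_iff.mp hs)
    rwa [Finsupp.weight_apply, Finsupp.sum_fintype _ _ (by simp), Fin.sum_univ_two,
      Pi.one_apply, Pi.one_apply, smul_eq_mul, smul_eq_mul, mul_one, mul_one] at this
  have h1 : MvPolynomial.monomial s (f.coeff s) =
      f.coeff s • (MvPolynomial.X 0 ^ s 0 * MvPolynomial.X 1 ^ s 1 : MvPolynomial (Fin 2) F) := by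
    rw [MvPolynomial.monomial_eq, Finsupp.prod_fintype _ _ (by simp), Fin.prod_univ_two,
      MvPolynomial.smul_eq_C_mul]
  rw [h1, map_smul, map_smul]
  congr 1
  rw [map_mul, map_pow, map_pow, dehom_X_zero, dehom_X_one, one_pow, mul_one, homog_apply,
    Finset.sum_eq_single (s 0)]
  · rw [Polynomial.coeff_X_pow_self, one_smul]
    congr 2
    omega
  · intro i _ hi
    rw [Polynomial.coeff_X_pow, if_neg hi, zero_smul]
  · intro hi
    exact absurd (Finset.mem_range.mpr (by omega)) hi

theorem natDegree_dehom_le {n : ℕ} {f : MvPolynomial (Fin 2) F} (hf : f.IsHomogeneous n) :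
    (dehom F f).natDegree ≤ n := by
  rw [← homog_dehom hf, homog_apply, map_sum]
  refine Polynomial.natDegree_sum_le_of_forall_le _ _ fun i hi => ?_
  rw [map_smul, map_mul, map_pow, map_pow, dehom_X_zero, dehom_X_one, one_pow, mul_one]
  refine (Polynomial.natDegree_smul_le _ _).trans ((Polynomial.natDegree_X_pow_le i).trans ?_)
  have := Finset.mem_range.mp hi
  omega

theorem eq_zero_of_dehom_eq_zero {n : ℕ} {f : MvPolynomial (Fin 2) F} (hf : f.IsHomogeneous n)
    (h : dehom F f = 0) : f = 0 := by
  rw [← homog_dehom hf, h, map_zero]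

variable [CharP F p]

theorem V_isHomogeneous {t : ℕ} (f : (VSub p F t).toSubmodule) : f.1.IsHomogeneous (t - 1) := f.2

theorem V_apply_coe {t : ℕ} (A : G p) (f : (VSub p F t).toSubmodule) :
    (V p F t (op A) f : MvPolynomial (Fin 2) F) = subst F A f := rfl

/-- `V_t` is linearly isomorphic to the space of polynomials of degree less than `t`. -/
def VEquiv (p : ℕ) (F : Type*) [Field F] [CharP F p] (t : ℕ) :
    (VSub p F (t + 1)).toSubmodule ≃ₗ[F] Polynomial.degreeLT F (t + 1) where
  toFun f := ⟨dehom F f, mem_degreeLT_succ_iff.mpr (natDegree_dehom_le (V_isHomogeneous f))⟩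
  map_add' _ _ := Subtype.ext (map_add (dehom F) _ _)
  map_smul' _ _ := Subtype.ext (map_smul (dehom F) _ _)
  invFun h := ⟨homog F t h, homog_isHomogeneous t _⟩
  left_inv f := Subtype.ext (homog_dehom (V_isHomogeneous f))
  right_inv h := Subtype.ext (dehom_homog (mem_degreeLT_succ_iff.mp h.2))

theorem finrank_V {t : ℕ} (ht : 1 ≤ t) : Module.finrank F (VSub p F t).toSubmodule = t := by
  obtain ⟨t, rfl⟩ := Nat.exists_eq_add_of_le' ht
  rw [(VEquiv p F t).finrank_eq, (Polynomial.degreeLTEquiv F (t + 1)).finrank_eq,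
    Module.finrank_fin_fun]

theorem finite_V {t : ℕ} (ht : 1 ≤ t) : Module.Finite F (VSub p F t).toSubmodule :=
  Module.finite_of_finrank_pos (by rw [finrank_V ht]; exact ht)

theorem dehom_subst_g (f : MvPolynomial (Fin 2) F) :
    dehom F (subst F (g p).1 f) = (dehom F f).comp (Polynomial.X + 1) := by
  have h1 : (dehom F).comp (subst F (g p).1) =
      (Polynomial.aeval (Polynomial.X + 1 : Polynomial F)).comp (dehom F) := by
    apply MvPolynomial.algHom_ext
    intro i
    rw [AlgHom.comp_apply, AlgHom.comp_apply, subst_X]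
    fin_cases i <;> simp [g, dehom, Fin.sum_univ_two]
  exact DFunLike.congr_fun h1 f

/-- The Weyl element `(0 1; -1 0)`. -/
def weyl (p : ℕ) : G p := ⟨!![0, 1; -1, 0], by simp [Matrix.det_fin_two]⟩

theorem subst_weyl_X_one : subst F (weyl p) (MvPolynomial.X 1) = -MvPolynomial.X 0 := by
  rw [subst_X]
  simp [weyl, Fin.sum_univ_two]

/-- `V_t` is simple. -/
theorem V_subrep_eq_top {t : ℕ} (ht : 1 ≤ t) (htp : t ≤ p)
    (N : Subrepresentation (V p F t)) {f : (VSub p F t).toSubmodule} (hf : f ∈ N) (hf0 : f ≠ 0) :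
    N = ⊤ := by
  have key : ∀ f h : (VSub p F t).toSubmodule, f ∈ N → f ≠ 0 →
      (dehom F h).natDegree ≤ (dehom F f).natDegree → h ∈ N := by
    intro f h hf hf0 hh
    have hd0 : dehom F f ≠ 0 := fun h0 =>
      hf0 (Subtype.ext (eq_zero_of_dehom_eq_zero (V_isHomogeneous f) h0))
    have hlt : (dehom F f).natDegree < p := by
      have := natDegree_dehom_le (V_isHomogeneous f)
      omega
    have hmem : dehom F h ∈ N.toSubmodule.map
        ((dehom F).toLinearMap ∘ₗ (VSub p F t).toSubmodule.subtype) := by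
      refine mem_of_natDegree_le_of_shift (f := dehom F f) _ ?_ hlt
        (Submodule.mem_map.mpr ⟨f, hf, rfl⟩) le_rfl
        (Polynomial.leadingCoeff_ne_zero.mpr hd0) hh
      rintro _ ⟨y, hy, rfl⟩
      exact ⟨_, N.apply_mem_toSubmodule (op (g p).1) hy, dehom_subst_g y.1⟩
    obtain ⟨y, hy, hyh⟩ := hmem
    have hyh' : dehom F (y - h : (VSub p F t).toSubmodule).1 = 0 := by
      change dehom F (y.1 - h.1) = 0
      rw [map_sub, sub_eq_zero]
      exact hyh
    have : y - h = 0 := Subtype.ext (eq_zero_of_dehom_eq_zero (V_isHomogeneous (y - h)) hyh')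
    rw [← sub_eq_zero.mp this]
    exact hy
  -- `y^(t-1)` dehomogenises to a constant, so it lies in every nonzero submodule; the Weyl element
  -- sends it to `± x^(t-1)`, of top degree, which generates the rest under shifts.
  let yn : (VSub p F t).toSubmodule :=
    ⟨MvPolynomial.X 1 ^ (t - 1), MvPolynomial.isHomogeneous_X_pow _ _⟩
  have hyn : yn ∈ N := key f yn hf hf0 (by simp [yn, dehom_X_one])
  have hxn : V p F t (op (weyl p)) yn ∈ N := N.apply_mem_toSubmodule _ hyn
  have hdx : dehom F (V p F t (op (weyl p)) yn).1 = (-Polynomial.X) ^ (t - 1) := by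
    rw [V_apply_coe]
    simp [yn, subst_weyl_X_one, dehom_X_zero]
  refine top_unique fun h _ => key _ h hxn ?_ ?_
  · intro h0
    rw [h0] at hdx
    have : (-Polynomial.X : Polynomial F) ^ (t - 1) ≠ 0 :=
      pow_ne_zero _ (neg_ne_zero.mpr Polynomial.X_ne_zero)
    exact this (by rw [← hdx]; exact map_zero _)
  · rw [hdx, Polynomial.natDegree_pow, Polynomial.natDegree_neg, Polynomial.natDegree_X, mul_one]
    exact natDegree_dehom_le (V_isHomogeneous h)

end Simple

/-! ### Functions on `𝔽_p²` -/

section Functions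

variable {p : ℕ} {F : Type*} [Field F]

/-- In a monomial of degree below `2 (p - 1)`, one of the two exponents is below `p - 1`, and that
power sums to zero over `𝔽_p`. -/
theorem sum_eval_eq_zero [Fact p.Prime] {R : Type*} [CommRing R] (φ : ZMod p →+* R)
    {Q : MvPolynomial (Fin 2) R} {n : ℕ} (hQ : Q.IsHomogeneous n) (hn : n < 2 * (p - 1)) :
    ∑ w : Fin 2 → ZMod p, MvPolynomial.eval (fun i => φ (w i)) Q = 0 := by
  rw [Q.as_sum]
  simp only [map_sum]
  rw [Finset.sum_comm]
  refine Finset.sum_eq_zero fun s hs => ?_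
  have hs' : s 0 + s 1 = n := by
    have := hQ (MvPolynomial.mem_support_iff.mp hs)
    rwa [Finsupp.weight_apply, Finsupp.sum_fintype _ _ (by simp), Fin.sum_univ_two,
      Pi.one_apply, Pi.one_apply, smul_eq_mul, smul_eq_mul, mul_one, mul_one] at this
  have hi : ∃ i, s i < p - 1 := by
    by_contra! hcon
    have h0 := hcon 0
    have h1 := hcon 1
    omega
  obtain ⟨i, hi⟩ := hi
  have hz : ∑ x : ZMod p, x ^ s i = 0 :=
    FiniteField.sum_pow_lt_card_sub_one (ZMod p) _ (by rwa [ZMod.card])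
  simp only [MvPolynomial.eval_monomial]
  rw [← Finset.mul_sum]
  have h1 : ∑ w : Fin 2 → ZMod p, (s.prod fun i k => φ (w i) ^ k) =
      ∏ i, ∑ x : ZMod p, φ x ^ s i := by
    rw [Finset.prod_univ_sum, Fintype.piFinset_univ]
    exact Finset.sum_congr rfl fun w _ => Finsupp.prod_fintype _ _ (by simp)
  rw [h1, Finset.prod_eq_zero (Finset.mem_univ i), mul_zero]
  simp only [← map_pow, ← map_sum, hz, map_zero]

/-- The right action of `G` on functions on `𝔽_p²`, `(f · A) (w) = f (A w)`. -/
def funRep (p : ℕ) (F : Type*) [Field F] :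
    Representation F (G p)ᵐᵒᵖ ((Fin 2 → ZMod p) → F) where
  toFun A := LinearMap.funLeft F F fun w => A.unop.1 *ᵥ w
  map_one' := by
    ext
    simp [LinearMap.funLeft_apply]
  map_mul' A A' := by
    refine LinearMap.ext fun f => funext fun w => ?_
    change f ((A'.unop.1 * A.unop.1) *ᵥ w) = f (A'.unop.1 *ᵥ (A.unop.1 *ᵥ w))
    rw [Matrix.mulVec_mulVec]

theorem funRep_apply (A : G p) (f : (Fin 2 → ZMod p) → F) (w : Fin 2 → ZMod p) :
    funRep p F (op A) f w = f (A.1 *ᵥ w) := rfl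

theorem mulVec_eq_zero_iff (A : G p) (w : Fin 2 → ZMod p) : A.1 *ᵥ w = 0 ↔ w = 0 :=
  (Matrix.SpecialLinearGroup.toLin' A).map_eq_zero_iff

variable [CharP F p]

/-- Evaluation of a polynomial at a vector of `𝔽_p²`. -/
def evalVec (F : Type*) [Field F] [CharP F p] (w : Fin 2 → ZMod p) :
    MvPolynomial (Fin 2) F →ₐ[F] F :=
  MvPolynomial.aeval fun i => ZMod.castHom (dvd_refl p) F (w i)

theorem evalVec_X (w : Fin 2 → ZMod p) (i : Fin 2) :
    evalVec F w (MvPolynomial.X i) = ZMod.castHom (dvd_refl p) F (w i) := by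
  rw [evalVec, MvPolynomial.aeval_X]

theorem evalVec_C (w : Fin 2 → ZMod p) (c : F) : evalVec F w (MvPolynomial.C c) = c :=
  MvPolynomial.algHom_C _ _

theorem evalVec_subst (A : G p) (w : Fin 2 → ZMod p) (f : MvPolynomial (Fin 2) F) :
    evalVec F w (subst F A f) = evalVec F (A.1 *ᵥ w) f := by
  have h1 : (evalVec F w).comp (subst F A) = evalVec F (A.1 *ᵥ w) := by
    apply MvPolynomial.algHom_ext
    intro i
    rw [AlgHom.comp_apply, subst_X, evalVec_X, map_sum, Matrix.mulVec, dotProduct, map_sum]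
    simp only [map_mul, evalVec_X, evalVec_C]
  exact DFunLike.congr_fun h1 f

theorem evalVec_smul {n : ℕ} {f : MvPolynomial (Fin 2) F} (hf : f.IsHomogeneous n)
    (c : ZMod p) (w : Fin 2 → ZMod p) :
    evalVec F (c • w) f = ZMod.castHom (dvd_refl p) F c ^ n * evalVec F w f := by
  rw [← homog_dehom hf, homog_apply, map_sum, map_sum, Finset.mul_sum]
  refine Finset.sum_congr rfl fun i hi => ?_
  have hin : n = i + (n - i) := by
    have := Finset.mem_range.mp hi
    omega
  simp only [map_smul, map_mul, map_pow, evalVec_X, Pi.smul_apply, smul_eq_mul]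
  generalize n - i = j at hin
  subst hin
  ring

/-- The function on `𝔽_p²` given by a polynomial away from zero, and by `0` at zero. -/
def evalMap (p : ℕ) (F : Type*) [Field F] [CharP F p] (t : ℕ) :
    (V p F t).IntertwiningMap (funRep p F) where
  toFun f w := if w = 0 then 0 else evalVec F w f.1
  map_add' f h := by
    funext w
    by_cases hw : w = 0 <;> simp [hw]
  map_smul' c f := by
    funext w
    by_cases hw : w = 0 <;> simp [hw]
  isIntertwining' A := by
    refine LinearMap.ext fun f => funext fun w => ?_
    change (if w = 0 then 0 else evalVec F w (subst F A.unop f.1)) =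
      (if A.unop.1 *ᵥ w = 0 then 0 else evalVec F (A.unop.1 *ᵥ w) f.1)
    simp only [evalVec_subst, mulVec_eq_zero_iff]

theorem evalMap_apply {t : ℕ} (f : (VSub p F t).toSubmodule) (w : Fin 2 → ZMod p) :
    evalMap p F t f w = if w = 0 then 0 else evalVec F w f.1 := rfl

/-- The linear form `w₀ y - w₁ x`. -/
def lin (F : Type*) [Field F] [CharP F p] (w : Fin 2 → ZMod p) : MvPolynomial (Fin 2) F :=
  MvPolynomial.C (ZMod.castHom (dvd_refl p) F (w 0)) * MvPolynomial.X 1 -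
    MvPolynomial.C (ZMod.castHom (dvd_refl p) F (w 1)) * MvPolynomial.X 0

theorem lin_zero : lin F (0 : Fin 2 → ZMod p) = 0 := by simp [lin]

theorem lin_isHomogeneous (w : Fin 2 → ZMod p) : (lin F w).IsHomogeneous 1 := by
  have h : ∀ (c : F) (i : Fin 2), (MvPolynomial.C c * MvPolynomial.X i).IsHomogeneous 1 :=
    fun c i => by
      simpa only [zero_add] using (MvPolynomial.isHomogeneous_C (Fin 2) c).mul
        (MvPolynomial.isHomogeneous_X F i)
  exact (h _ _).sub (h _ _)

/-- The form is the determinant of the columns `w` and `(x, y)`, which `A` preserves because `det A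
= 1`. This is what makes `sumMap` equivariant. -/
theorem subst_lin (A : G p) (w : Fin 2 → ZMod p) : subst F A (lin F (A.1 *ᵥ w)) = lin F w := by
  have hd := A.2
  rw [Matrix.det_fin_two] at hd
  have hd' := congrArg (fun c => MvPolynomial.C (σ := Fin 2) (ZMod.castHom (dvd_refl p) F c)) hd
  simp only [map_sub, map_mul, map_one] at hd'
  have hC : ∀ c : F, subst F A (MvPolynomial.C c) = MvPolynomial.C c :=
    fun c => MvPolynomial.algHom_C _ _
  simp only [lin, map_sub, map_mul, hC, subst_X, Fin.sum_univ_two, Matrix.mulVec, dotProduct,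
    map_add]
  linear_combination (MvPolynomial.C (ZMod.castHom (dvd_refl p) F (w 0)) * MvPolynomial.X 1 -
    MvPolynomial.C (ZMod.castHom (dvd_refl p) F (w 1)) * MvPolynomial.X 0) * hd'

variable [Fact p.Prime]

/-- The map `f ↦ ∑ f (w) (w₀ y - w₁ x)^(t-1)` from functions on `𝔽_p²` to `V_t`. -/
def sumMap (p : ℕ) [Fact p.Prime] (F : Type*) [Field F] [CharP F p] (t : ℕ) :
    (funRep p F).IntertwiningMap (V p F t) where
  toFun f := ⟨∑ w, f w • lin F w ^ (t - 1), Submodule.sum_mem _ fun w _ =>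
    Submodule.smul_mem _ _ (by
      simpa only [one_mul] using! (lin_isHomogeneous w).pow (t - 1))⟩
  map_add' f h := Subtype.ext <| by
    simp [add_smul, Finset.sum_add_distrib]
  map_smul' c f := Subtype.ext <| by
    simp [mul_smul, Finset.smul_sum]
  isIntertwining' A := by
    refine LinearMap.ext fun f => Subtype.ext ?_
    change ∑ w, f (A.unop.1 *ᵥ w) • lin F w ^ (t - 1) =
      subst F A.unop (∑ w, f w • lin F w ^ (t - 1))
    rw [map_sum]
    refine Fintype.sum_equiv (Matrix.SpecialLinearGroup.toLin' A.unop).toEquiv _ _ fun w => ?_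
    change _ = subst F A.unop (f (A.unop.1 *ᵥ w) • lin F (A.unop.1 *ᵥ w) ^ (t - 1))
    rw [map_smul, map_pow, subst_lin]

theorem sumMap_apply_coe {t : ℕ} (f : (Fin 2 → ZMod p) → F) :
    (sumMap p F t f).1 = ∑ w, f w • lin F w ^ (t - 1) := rfl

theorem sumMap_evalMap {s t : ℕ} (ht : 2 ≤ t) (hst : (s - 1) + (t - 1) < 2 * (p - 1))
    (f : (VSub p F s).toSubmodule) : sumMap p F t (evalMap p F s f) = 0 := by
  apply Subtype.ext
  rw [sumMap_apply_coe]
  let φ : ZMod p →+* MvPolynomial (Fin 2) F :=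
    MvPolynomial.C.comp (ZMod.castHom (dvd_refl p) F)
  -- The summand viewed as a polynomial in the coordinates of `w`, with coefficients in `F[x, y]`.
  let Q : MvPolynomial (Fin 2) (MvPolynomial (Fin 2) F) :=
    MvPolynomial.map MvPolynomial.C f.1 *
      (MvPolynomial.C (MvPolynomial.X 1) * MvPolynomial.X 0 -
        MvPolynomial.C (MvPolynomial.X 0) * MvPolynomial.X 1) ^ (t - 1)
  have hQ : Q.IsHomogeneous ((s - 1) + (t - 1)) := by
    have h : ∀ (c : MvPolynomial (Fin 2) F) (i : Fin 2),
        (MvPolynomial.C c * MvPolynomial.X i).IsHomogeneous 1 := fun c i => by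
      simpa only [zero_add] using (MvPolynomial.isHomogeneous_C (Fin 2) c).mul
        (MvPolynomial.isHomogeneous_X _ i)
    have h1 := (((h (MvPolynomial.X 1) 0).sub (h (MvPolynomial.X 0) 1)).pow (t - 1))
    rw [one_mul] at h1
    exact (MvPolynomial.IsHomogeneous.map (V_isHomogeneous f) _).mul h1
  refine Eq.trans ?_ (sum_eval_eq_zero φ hQ hst)
  refine Finset.sum_congr rfl fun w _ => ?_
  rw [evalMap_apply]
  have h2 : MvPolynomial.eval (fun i => φ (w i)) (MvPolynomial.map MvPolynomial.C f.1) =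
      MvPolynomial.C (evalVec F w f.1) := by
    rw [MvPolynomial.eval_map, evalVec, MvPolynomial.aeval_def, MvPolynomial.eval₂_comp_left]
    rfl
  have h3 : MvPolynomial.eval (fun i => φ (w i)) Q =
      MvPolynomial.C (evalVec F w f.1) * lin F w ^ (t - 1) := by
    simp only [Q, map_mul, map_pow, map_sub, h2, MvPolynomial.eval_C, MvPolynomial.eval_X, lin]
    congr 2
    simp only [φ, RingHom.comp_apply]
    ring
  rw [h3]
  split_ifs with hw
  -- `evalMap` is set to zero at the origin while a constant polynomial is not; the discrepancy is
  -- killed by the factor `0 ^ (t - 1)`, where `2 ≤ t` is needed.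
  · rw [hw, lin_zero, zero_pow (by omega), mul_zero, smul_zero]
  · rw [MvPolynomial.smul_eq_C_mul]

/-- On the points `(c, 1)` the dehomogenised polynomial has `p` zeros but degree at most `t - 1 <
p`. -/
theorem evalMap_injective {t : ℕ} (ht : 1 ≤ t) (htp : t ≤ p) :
    Function.Injective (evalMap p F t) := by
  rw [injective_iff_map_eq_zero]
  intro f hf
  apply Subtype.ext
  refine eq_zero_of_dehom_eq_zero (V_isHomogeneous f) ?_
  have hev : ∀ (c : ZMod p), (dehom F f.1).eval (ZMod.castHom (dvd_refl p) F c) = 0 := by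
    intro c
    have h1 := congrFun hf ![c, 1]
    rw [evalMap_apply, if_neg (by intro h0; simpa using congrFun h0 1)] at h1
    have h2 : (Polynomial.aeval (ZMod.castHom (dvd_refl p) F c)).comp (dehom F) =
        evalVec F ![c, 1] := by
      apply MvPolynomial.algHom_ext
      intro i
      rw [AlgHom.comp_apply, evalVec_X]
      fin_cases i <;> simp [dehom]
    have h3 := DFunLike.congr_fun h2 f.1
    rw [h1, AlgHom.comp_apply, Polynomial.coe_aeval_eq_eval] at h3
    exact h3
  refine Polynomial.eq_zero_of_natDegree_lt_card_of_eval_eq_zero _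
    (ZMod.castHom (dvd_refl p) F).injective hev ?_
  rw [ZMod.card]
  have := natDegree_dehom_le (V_isHomogeneous f)
  omega

/-- The functions `f` on `𝔽_p²` with `f (0) = 0` and `f (c w) = c ^ d f (w)` for `c ≠ 0`. -/
def funSub (p : ℕ) (F : Type*) [Field F] [CharP F p] (d : ℕ) :
    Subrepresentation (funRep p F) where
  toSubmodule :=
    { carrier := {f | f 0 = 0 ∧ ∀ (c : ZMod p) w, c ≠ 0 →
        f (c • w) = ZMod.castHom (dvd_refl p) F c ^ d * f w}
      add_mem' := by
        rintro f h ⟨hf, hf'⟩ ⟨hh, hh'⟩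
        refine ⟨by simp [hf, hh], fun c w hc => ?_⟩
        rw [Pi.add_apply, Pi.add_apply, hf' c w hc, hh' c w hc, mul_add]
      zero_mem' := ⟨rfl, fun c w hc => by simp⟩
      smul_mem' := by
        rintro r f ⟨hf, hf'⟩
        refine ⟨by simp [hf], fun c w hc => ?_⟩
        rw [Pi.smul_apply, Pi.smul_apply, hf' c w hc, smul_eq_mul, smul_eq_mul, mul_left_comm] }
  apply_mem_toSubmodule A f hf := by
    refine ⟨?_, fun c w hc => ?_⟩
    · change f (A.unop.1 *ᵥ 0) = 0
      rw [Matrix.mulVec_zero, hf.1]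
    · change f (A.unop.1 *ᵥ (c • w)) = _ * f (A.unop.1 *ᵥ w)
      rw [Matrix.mulVec_smul, hf.2 c _ hc]

theorem mem_funSub {d : ℕ} {f : (Fin 2 → ZMod p) → F} : f ∈ (funSub p F d).toSubmodule ↔
    f 0 = 0 ∧ ∀ (c : ZMod p) w, c ≠ 0 →
      f (c • w) = ZMod.castHom (dvd_refl p) F c ^ d * f w := Iff.rfl

theorem evalMap_mem_funSub {t : ℕ} (f : (VSub p F t).toSubmodule) :
    evalMap p F t f ∈ (funSub p F (t - 1)).toSubmodule := by
  refine ⟨by simp [evalMap_apply], fun c w hc => ?_⟩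
  rw [evalMap_apply, evalMap_apply, evalVec_smul (V_isHomogeneous f)]
  by_cases hw : w = 0
  · simp [hw]
  · rw [if_neg hw, if_neg (smul_ne_zero hc hw)]

/-- A homogeneous function is determined by its values at representatives of the `p + 1` points of
the projective line. -/
theorem finrank_funSub_le (d : ℕ) :
    Module.finrank F (funSub p F d).toSubmodule ≤ p + 1 := by
  let pt : Option (ZMod p) → Fin 2 → ZMod p := fun o => o.elim ![1, 0] fun c => ![c, 1]
  let L : (funSub p F d).toSubmodule →ₗ[F] Option (ZMod p) → F :=
    LinearMap.funLeft F F pt ∘ₗ (funSub p F d).toSubmodule.subtype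
  have hL : Function.Injective L := by
    rw [injective_iff_map_eq_zero]
    intro f hf
    apply Subtype.ext
    funext w
    have hpt : ∀ o, f.1 (pt o) = 0 := fun o => congrFun hf o
    by_cases h1 : w 1 = 0
    · by_cases h0 : w 0 = 0
      · have : w = 0 := by
          funext i
          fin_cases i
          · exact h0
          · exact h1
        rw [this]
        exact f.2.1
      · have : w = w 0 • pt none := by
          funext i
          fin_cases i <;> simp [pt, h1]
        rw [this, f.2.2 _ _ h0, hpt, mul_zero]
        rfl
    · have : w = w 1 • pt (some (w 0 / w 1)) := by
        funext i
        fin_cases i <;> simp [pt, mul_div_cancel₀ _ h1]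
      rw [this, f.2.2 _ _ h1, hpt, mul_zero]
      rfl
  have := LinearMap.finrank_le_finrank_of_injective hL
  rwa [Module.finrank_fintype_fun_eq_card, Fintype.card_option, ZMod.card] at this

theorem exists_sumMap_ne_zero {d t : ℕ} (hdt : d + t = p) (ht : 2 ≤ t) :
    ∃ f ∈ (funSub p F d).toSubmodule, sumMap p F t f ≠ 0 := by
  let c := ZMod.castHom (dvd_refl p) F
  -- Supported on the line `w₁ = 0`, where each summand is `x^(d+t-1) = x^(p-1) = 1` times
  -- `y^(t-1)`. The image is `(p - 1) y^(t-1)`, detected by evaluation at `(0, 1)`.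
  refine ⟨fun w => if w 1 = 0 ∧ w 0 ≠ 0 then c (w 0) ^ d else 0, ⟨by simp, ?_⟩, ?_⟩
  · intro r w hr
    simp only [Pi.smul_apply, smul_eq_mul, mul_eq_zero, hr, false_or, ne_eq, map_mul, mul_pow,
      mul_ite, mul_zero]
    rfl
  · intro h0
    have h1 := congrArg (fun f => evalVec F ![(0 : ZMod p), 1] f.1) h0
    simp only [sumMap_apply_coe, map_sum, map_smul, map_pow] at h1
    have h2 : ∀ w : Fin 2 → ZMod p, evalVec F ![(0 : ZMod p), 1] (lin F w) = c (w 0) := by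
      intro w
      rw [lin, map_sub, map_mul, map_mul, evalVec_X, evalVec_X, evalVec_C, evalVec_C]
      simp [c]
    simp only [h2] at h1
    rw [← (finTwoArrowEquiv (ZMod p)).symm.sum_comp, Fintype.sum_prod_type] at h1
    have h3 : ∀ x y : ZMod p,
        ((if (finTwoArrowEquiv (ZMod p)).symm (x, y) 1 = 0 ∧
          (finTwoArrowEquiv (ZMod p)).symm (x, y) 0 ≠ 0 then
            c ((finTwoArrowEquiv (ZMod p)).symm (x, y) 0) ^ d else 0) •
          c ((finTwoArrowEquiv (ZMod p)).symm (x, y) 0) ^ (t - 1)) =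
        if y = 0 then (if x ≠ 0 then 1 else 0) else 0 := by
      intro x y
      by_cases hy : y = 0
      · by_cases hx : x = 0
        · simp [hy, hx]
        · have h4 : c x ^ (d + (t - 1)) = 1 := by
            rw [← map_pow, show d + (t - 1) = p - 1 by omega, ZMod.pow_card_sub_one_eq_one hx,
              map_one]
          simp [hy, hx, ← pow_add, h4]
      · simp [hy]
    simp only [h3, Finset.sum_ite_eq', Finset.mem_univ, if_true, Finset.sum_boole] at h1
    rw [Finset.filter_ne', Finset.card_erase_of_mem (Finset.mem_univ _), Finset.card_univ,
      ZMod.card] at h1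
    have h5 : ((p - 1 : ℕ) : F) = 0 := h1.trans (map_zero _)
    rw [CharP.cast_eq_zero_iff F p] at h5
    exact absurd (Nat.le_of_dvd (by omega) h5) (by omega)

/-- The restriction of `sumMap` to `funSub`. -/
def sumMapSub (p : ℕ) [Fact p.Prime] (F : Type*) [Field F] [CharP F p] (d t : ℕ) :
    (funSub p F d).toRepresentation.IntertwiningMap (V p F t) where
  toLinearMap := (sumMap p F t).toLinearMap ∘ₗ (funSub p F d).toSubmodule.subtype
  isIntertwining' A := LinearMap.ext fun f => map_apply_rep (sumMap p F t) A f.1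

theorem sumMapSub_surjective {d t : ℕ} (hdt : d + t = p) (ht : 2 ≤ t) :
    Function.Surjective (sumMapSub p F d t) := by
  obtain ⟨f, hf, hf0⟩ := exists_sumMap_ne_zero (F := F) hdt ht
  have h1 : (sumMapSub p F d t).range = ⊤ :=
    V_subrep_eq_top (by omega) (by omega) _ (f := sumMapSub p F d t ⟨f, hf⟩) ⟨_, rfl⟩ hf0
  intro v
  have : v ∈ (sumMapSub p F d t).range := by rw [h1]; trivial
  exact this

/-- A complex `V → W → U`, injective on the left and surjective on the right, is exact in the middle
once `dim W ≤ dim V + dim U`; only the upper bound on `funSub` is therefore needed. -/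
theorem exists_apply_eq_of_finrank_le {V W U : Type*} [AddCommGroup V] [Module F V]
    [AddCommGroup W] [Module F W] [AddCommGroup U] [Module F U] [Module.Finite F V]
    [Module.Finite F W] (e : V →ₗ[F] W) (q : W →ₗ[F] U) (he : Function.Injective e)
    (hq : Function.Surjective q) (hqe : ∀ v, q (e v) = 0)
    (hle : Module.finrank F W ≤ Module.finrank F V + Module.finrank F U) {w : W} (hw : q w = 0) :
    ∃ v, e v = w := by
  have h1 := LinearMap.finrank_range_add_finrank_ker q
  rw [LinearMap.range_eq_top.mpr hq, finrank_top] at h1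
  have h2 : LinearMap.range e = LinearMap.ker q := by
    refine Submodule.eq_of_le_of_finrank_le ?_ ?_
    · rintro _ ⟨v, rfl⟩
      exact hqe v
    · rw [LinearMap.finrank_range_of_inj he]
      omega
  have h3 : w ∈ LinearMap.ker q := hw
  rwa [← h2] at h3

/-- The sequence `V_{d+1} → funSub d → V_{p-d}` is exact. -/
theorem exists_evalMap_eq {d t : ℕ} (hdt : d + t = p) (ht : 2 ≤ t)
    {f : (Fin 2 → ZMod p) → F} (hf : f ∈ (funSub p F d).toSubmodule) (hf0 : sumMap p F t f = 0) :
    ∃ h, evalMap p F (d + 1) h = f := by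
  have := finite_V (p := p) (F := F) (t := d + 1) (by omega)
  have : Module.Finite F (funSub p F d).toSubmodule :=
    FiniteDimensional.finiteDimensional_submodule _
  obtain ⟨h, hh⟩ := exists_apply_eq_of_finrank_le
    ((evalMap p F (d + 1)).toLinearMap.codRestrict (funSub p F d).toSubmodule evalMap_mem_funSub)
    (sumMapSub p F d t).toLinearMap (fun a b hab => evalMap_injective (p := p) (F := F)
      (t := d + 1) (by omega) (by omega) (congrArg Subtype.val hab)) (sumMapSub_surjective hdt ht)
    (fun h => sumMap_evalMap ht (by omega) h)
    (by
      rw [finrank_V (by omega), finrank_V (by omega)]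
      exact (finrank_funSub_le d).trans (by omega)) (w := ⟨f, hf⟩) hf0
  exact ⟨h, congrArg Subtype.val hh⟩

end Functions

/-! ### Homogeneous components and Frobenius reciprocity -/

section Frobenius

variable {p : ℕ} {F : Type*} [Field F]

/-- Orthogonality of the characters of `𝔽_pˣ`. The value `-1` is `p - 1` in `F`, the source of the
sign in `sum_component`. -/
theorem geom_sum_units [Fact p.Prime] [CharP F p] (x : (ZMod p)ˣ) :
    ∑ d ∈ Finset.range (p - 1), ZMod.castHom (dvd_refl p) F (x : ZMod p) ^ d =
      if x = 1 then -1 else 0 := by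
  have hp := (Fact.out : p.Prime).one_le
  split_ifs with hx
  · rw [hx]
    simp [Nat.cast_sub hp]
  · have hne : ZMod.castHom (dvd_refl p) F (x : ZMod p) ≠ 1 := by
      intro h
      rw [← map_one (ZMod.castHom (dvd_refl p) F)] at h
      exact hx (Units.ext ((ZMod.castHom (dvd_refl p) F).injective h))
    rw [geom_sum_eq hne, ← map_pow, ZMod.pow_card_sub_one_eq_one x.ne_zero, map_one, sub_self,
      zero_div]

/-- The projection of functions on `𝔽_p²` to the homogeneous functions of degree `d`, up to
sign. -/
def component (p : ℕ) [Fact p.Prime] (F : Type*) [Field F] [CharP F p] (d : ℕ) :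
    (funRep p F).IntertwiningMap (funRep p F) where
  toFun f w := ∑ c : (ZMod p)ˣ,
    ZMod.castHom (dvd_refl p) F ((c⁻¹ : (ZMod p)ˣ) : ZMod p) ^ d * f ((c : ZMod p) • w)
  map_add' f h := by
    funext w
    simp only [Pi.add_apply, mul_add, Finset.sum_add_distrib]
  map_smul' r f := by
    funext w
    simp only [Pi.smul_apply, smul_eq_mul, RingHom.id_apply, Finset.mul_sum]
    exact Finset.sum_congr rfl fun c _ => mul_left_comm _ _ _
  isIntertwining' A := by
    refine LinearMap.ext fun f => funext fun w => ?_
    refine Finset.sum_congr rfl fun c _ => ?_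
    change _ * f (A.unop.1 *ᵥ ((c : ZMod p) • w)) = _ * f ((c : ZMod p) • A.unop.1 *ᵥ w)
    rw [Matrix.mulVec_smul]

theorem component_apply [Fact p.Prime] [CharP F p] (d : ℕ) (f : (Fin 2 → ZMod p) → F) (w : Fin 2 → ZMod p) :
    component p F d f w = ∑ c : (ZMod p)ˣ,
      ZMod.castHom (dvd_refl p) F ((c⁻¹ : (ZMod p)ˣ) : ZMod p) ^ d * f ((c : ZMod p) • w) := rfl

theorem component_mem_funSub [Fact p.Prime] [CharP F p] (d : ℕ) {f : (Fin 2 → ZMod p) → F} (hf : f 0 = 0) :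
    component p F d f ∈ (funSub p F d).toSubmodule := by
  refine ⟨by simp only [component_apply, smul_zero, hf, mul_zero, Finset.sum_const_zero], fun c w hc => ?_⟩
  obtain ⟨c, rfl⟩ := hc.isUnit
  rw [component_apply, component_apply, Finset.mul_sum]
  refine Fintype.sum_equiv (Equiv.mulRight c) _ _ fun e => ?_
  rw [Equiv.coe_mulRight, ← mul_assoc, ← mul_pow, ← map_mul, smul_smul, ← Units.val_mul,
    ← Units.val_mul]
  congr 5
  rw [mul_inv, mul_comm c, inv_mul_cancel_right]

theorem sum_component [Fact p.Prime] [CharP F p] (f : (Fin 2 → ZMod p) → F) :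
    ∑ d ∈ Finset.range (p - 1), component p F d f = -f := by
  funext w
  simp only [Finset.sum_apply, component_apply]
  rw [Finset.sum_comm]
  simp only [← Finset.sum_mul, geom_sum_units, inv_eq_one, ite_mul, zero_mul,
    Finset.sum_ite_eq', Finset.mem_univ, if_true, Units.val_one, one_smul, neg_mul, one_mul,
    Pi.neg_apply]

theorem g_pow_coe (j : ℕ) : ((g p ^ j : B p).1.1 : Matrix (Fin 2) (Fin 2) (ZMod p)) =
    !![1, (j : ZMod p); 0, 1] := by
  induction j with
  | zero =>
    ext i k
    fin_cases i <;> fin_cases k <;> simp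
  | succ j ih =>
    have h1 : (g p ^ (j + 1) : B p).1.1 = (g p ^ j : B p).1.1 * (g p).1.1 := by
      rw [pow_succ]; rfl
    have h2 : (g p).1.1 = !![1, 1; 0, 1] := rfl
    rw [h1, ih, h2]
    ext i k
    fin_cases i <;> fin_cases k <;> simp [Matrix.mul_apply, Fin.sum_univ_two, add_comm]

theorem exists_mulVec_eq [Fact p.Prime] {w : Fin 2 → ZMod p} (hw : w ≠ 0) :
    ∃ A : G p, A.1 *ᵥ ![1, 0] = w := by
  by_cases h0 : w 0 = 0
  · have h1 : w 1 ≠ 0 := by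
      intro h1
      apply hw
      funext i
      fin_cases i
      · exact h0
      · exact h1
    refine ⟨⟨!![0, -(w 1)⁻¹; w 1, 0], by simp [Matrix.det_fin_two, h1]⟩, ?_⟩
    funext i
    fin_cases i <;> simp [Matrix.mulVec, dotProduct, Fin.sum_univ_two, h0]
  · refine ⟨⟨!![w 0, 0; w 1, (w 0)⁻¹], by simp [Matrix.det_fin_two, h0]⟩, ?_⟩
    funext i
    fin_cases i <;> simp [Matrix.mulVec, dotProduct, Fin.sum_univ_two]

theorem mulVec_e (A : Matrix (Fin 2) (Fin 2) (ZMod p)) (i : Fin 2) :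
    (A *ᵥ ![1, 0]) i = A i 0 := by
  simp [Matrix.mulVec, dotProduct, Fin.sum_univ_two]

/-- The stabiliser of the column `(1, 0)` is `⟨g⟩`, which identifies `G/⟨g⟩` with the nonzero
vectors. -/
theorem exists_eq_mul_g_pow [NeZero p] {A A' : G p} (h : A.1 *ᵥ ![1, 0] = A'.1 *ᵥ ![1, 0]) :
    ∃ j : ℕ, A' = A * (g p ^ j : B p).1 := by
  have h1 : (A⁻¹ * A').1 *ᵥ ![1, 0] = ![1, 0] := by
    have h2 : (A⁻¹ * A').1 = A⁻¹.1 * A'.1 := rfl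
    have h3 : A⁻¹.1 * A.1 = 1 := congrArg Subtype.val (inv_mul_cancel A)
    rw [h2, ← Matrix.mulVec_mulVec, ← h, Matrix.mulVec_mulVec, h3, Matrix.one_mulVec]
  set Y := A⁻¹ * A' with hY
  have h00 : Y.1 0 0 = 1 := (mulVec_e Y.1 0).symm.trans (congrFun h1 0)
  have h10 : Y.1 1 0 = 0 := (mulVec_e Y.1 1).symm.trans (congrFun h1 1)
  have h11 : Y.1 1 1 = 1 := by
    have := Y.2
    rwa [Matrix.det_fin_two, h00, h10, mul_zero, sub_zero, one_mul] at this
  refine ⟨(Y.1 0 1).val, ?_⟩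
  have h4 : Y = (g p ^ (Y.1 0 1).val : B p).1 := by
    apply Subtype.ext
    rw [g_pow_coe, ZMod.natCast_zmod_val]
    ext i k
    fin_cases i <;> fin_cases k <;> simp [h00, h10, h11]
  rw [← h4, hY, mul_inv_cancel_left]

variable {P : Type*} [AddCommGroup P] [Module F P] {σ : Representation F (G p)ᵐᵒᵖ P}

theorem apply_g_pow {M N : Type*} [AddCommGroup M] [Module F M] [AddCommGroup N] [Module F N]
    {ρ : Representation F (B p)ᵐᵒᵖ M} {f : M →ₗ[F] N} (hf : ∀ v, f (ρ (op (g p)) v) = f v)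
    (j : ℕ) (v : M) : f (ρ (op (g p ^ j)) v) = f v := by
  induction j generalizing v with
  | zero => simp
  | succ j ih =>
    rw [pow_succ, op_mul, map_mul, Module.End.mul_apply, hf, ih]

/-- A linear form that is invariant under `g` comes from a map to the functions on `𝔽_p²`. -/
theorem exists_frobenius [Fact p.Prime] {f : P →ₗ[F] F} (hf : ∀ v, f (σ (op (g p).1) v) = f v) :
    ∃ Φ : σ.IntertwiningMap (funRep p F), (∀ v, Φ v 0 = 0) ∧ ∀ v, Φ v ![1, 0] = f v := by
  classical
  have hA : ∀ w : Fin 2 → ZMod p, ∃ A : G p, w ≠ 0 → A.1 *ᵥ ![1, 0] = w := by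
    intro w
    by_cases hw : w = 0
    · exact ⟨1, fun h => absurd hw h⟩
    · obtain ⟨A, hA⟩ := exists_mulVec_eq hw
      exact ⟨A, fun _ => hA⟩
  choose A hA using hA
  have he : (![1, 0] : Fin 2 → ZMod p) ≠ 0 := fun h => by simpa using congrFun h 0
  -- By invariance under `g`, the value `f (v · X)` depends only on the first column of `X`; this
  -- makes `Φ v w = f (v · A w)` well defined and equivariant.
  have hinv : ∀ X X' : G p, X.1 *ᵥ ![1, 0] = X'.1 *ᵥ ![1, 0] → ∀ v,
      f (σ (op X) v) = f (σ (op X') v) := by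
    intro X X' h v
    obtain ⟨j, rfl⟩ := exists_eq_mul_g_pow h
    rw [op_mul, map_mul, Module.End.mul_apply]
    exact (apply_g_pow (ρ := res σ) hf j _).symm
  refine ⟨{ toFun := fun v w => if w = 0 then 0 else f (σ (op (A w)) v)
            map_add' := fun v v' => ?_
            map_smul' := fun c v => ?_
            isIntertwining' := fun X => ?_ }, fun v => if_pos rfl, fun v => ?_⟩
  · funext w
    by_cases hw : w = 0 <;> simp [hw]
  · funext w
    by_cases hw : w = 0 <;> simp [hw]
  · refine LinearMap.ext fun v => funext fun w => ?_
    change (if w = 0 then 0 else f (σ (op (A w)) (σ X v))) =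
      if X.unop.1 *ᵥ w = 0 then 0 else f (σ (op (A (X.unop.1 *ᵥ w))) v)
    simp only [mulVec_eq_zero_iff]
    split_ifs with hw
    · rfl
    · rw [← Module.End.mul_apply, ← map_mul, ← op_unop X, ← op_mul]
      refine hinv _ _ ?_ v
      rw [hA _ ((mulVec_eq_zero_iff _ _).not.mpr hw)]
      change (X.unop.1 * (A w).1) *ᵥ ![1, 0] = _
      rw [← Matrix.mulVec_mulVec, hA w hw]
      rfl
  · change (if ![1, 0] = 0 then 0 else f (σ (op (A ![1, 0])) v)) = f v
    rw [if_neg he, hinv (A ![1, 0]) 1 (by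
      rw [hA _ he]
      exact (Matrix.one_mulVec _).symm)]
    simp

/-- The linear form `v ↦ Φ (v) (1, 0)`. -/
def evalE (Φ : σ.IntertwiningMap (funRep p F)) : P →ₗ[F] F :=
  LinearMap.proj (![1, 0] : Fin 2 → ZMod p) ∘ₗ Φ.toLinearMap

theorem evalE_apply (Φ : σ.IntertwiningMap (funRep p F)) (v : P) : evalE Φ v = Φ v ![1, 0] := rfl

theorem eq_zero_of_evalE_eq_zero [Fact p.Prime] {Φ : σ.IntertwiningMap (funRep p F)}
    (h0 : ∀ v, Φ v 0 = 0)
    (h : evalE Φ = 0) (v : P) : Φ v = 0 := by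
  funext w
  by_cases hw : w = 0
  · rw [hw, h0]; rfl
  · obtain ⟨A, rfl⟩ := exists_mulVec_eq hw
    have h1 := congrFun (map_apply_rep Φ (op A) v) ![1, 0]
    rw [funRep_apply] at h1
    rw [← h1]
    exact LinearMap.congr_fun h _

theorem B_mulVec_e (b : B p) : b.1.1 *ᵥ ![1, 0] = b.1.1 0 0 • ![1, 0] := by
  funext i
  rw [mulVec_e]
  fin_cases i
  · simp
  · simpa using B_apply_one_zero b

/-- The vector `(1, 0)` is an eigenvector of every element of `B`, with eigenvalue `α`, so
homogeneity of degree `d` yields the character `α ^ d`. -/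
theorem evalE_apply_B [Fact p.Prime] [CharP F p] {Φ : σ.IntertwiningMap (funRep p F)} {d : ℕ}
    (hΦ : ∀ v, Φ v ∈ (funSub p F d).toSubmodule) (b : B p) (v : P) :
    evalE Φ (σ (op b.1) v) = ZMod.castHom (dvd_refl p) F (b.1.1 0 0) ^ d * evalE Φ v := by
  rw [evalE_apply, evalE_apply, map_apply_rep, funRep_apply, B_mulVec_e,
    (hΦ v).2 _ _ (left_ne_zero_of_mul_eq_one (B_apply_mul b))]

theorem exists_factor {H : Type*} [Group H] {M N : Type*} [AddCommGroup M] [Module F M]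
    [AddCommGroup N] [Module F N] {σ : Representation F H P} {ρ : Representation F H M}
    {τ : Representation F H N} (f : ρ.IntertwiningMap τ) (hf : Function.Injective f)
    (h : σ.IntertwiningMap τ) (hh : ∀ v, ∃ x, f x = h v) :
    ∃ k : σ.IntertwiningMap ρ, ∀ v, f (k v) = h v := by
  choose k hk using hh
  refine ⟨{ toFun := k
            map_add' := fun v v' => hf (by rw [map_add, hk, hk, hk, map_add])
            map_smul' := fun c v => hf (by rw [RingHom.id_apply, map_smul, hk, hk, map_smul])
            isIntertwining' := fun x => LinearMap.ext fun v => hf ?_ }, hk⟩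
  change f (k (σ x v)) = f (ρ x (k v))
  rw [hk, map_apply_rep, map_apply_rep, hk]

end Frobenius

/-! ### Maps from the projective cover -/

section Cover

variable {p : ℕ} {F : Type*} [Field F] [CharP F p] {P : Type*} [AddCommGroup P] [Module F P]
  {σ : Representation F (G p)ᵐᵒᵖ P} {t : ℕ}

theorem V_eq_bot_or_top {s : ℕ} (hs1 : 1 ≤ s) (hsp : s ≤ p)
    (N : Subrepresentation (V p F s)) : N = ⊤ ∨ ∀ x ∈ N, x = 0 := by
  by_cases h : ∀ x ∈ N, x = 0
  · exact Or.inr h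
  · push Not at h
    obtain ⟨x, hx, hx0⟩ := h
    exact Or.inl (V_subrep_eq_top hs1 hsp N hx hx0)

/-- The image of a subrepresentation. -/
def mapSub {H M N : Type*} [Group H] [AddCommGroup M] [Module F M] [AddCommGroup N] [Module F N]
    {ρ : Representation F H M} {τ : Representation F H N} (f : ρ.IntertwiningMap τ)
    (X : Subrepresentation ρ) : Subrepresentation τ where
  toSubmodule := X.toSubmodule.map f.toLinearMap
  apply_mem_toSubmodule := by
    rintro h _ ⟨x, hx, rfl⟩
    exact ⟨ρ h x, X.apply_mem_toSubmodule h hx, map_apply_rep f h x⟩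

/-- The image of `f.ker` under `h` is zero or everything, and the second case would make the two
kernels span the module. -/
theorem ker_le_ker {M N : Type*} [AddCommGroup M] [Module F M] {H : Type*} [Group H]
    [AddCommGroup N] [Module F N] {σ : Representation F H P}
    {ρ : Representation F H M} {τ : Representation F H N} (f : σ.IntertwiningMap ρ)
    (h : σ.IntertwiningMap τ) (hne : f.ker ⊔ h.ker ≠ ⊤)
    (hsimple : ∀ X : Subrepresentation τ, X = ⊤ ∨ ∀ x ∈ X, x = 0) :
    ∀ v, f v = 0 → h v = 0 := by
  intro v hv
  rcases hsimple (mapSub h f.ker) with htop | hbot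
  · refine absurd ((sup_ker_eq_top_iff h f.ker).mpr fun w => ?_) hne
    have : h w ∈ mapSub h f.ker := by rw [htop]; trivial
    exact this
  · exact hbot _ ⟨v, hv, rfl⟩

/-- `π.ker` is superfluous, so a proper kernel plus `π.ker` stays proper; with both targets simple,
each kernel then contains the other. -/
theorem ker_eq_of_ne_zero {π : σ.IntertwiningMap (V p F t)}
    (hsup : ∀ X : Subrepresentation σ, X ⊔ π.ker = ⊤ → X = ⊤) (ht1 : 1 ≤ t) (htp : t ≤ p) {s : ℕ} (hs1 : 1 ≤ s) (hsp : s ≤ p)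
    (ψ : σ.IntertwiningMap (V p F s)) (hψ : ∃ v, ψ v ≠ 0) (v : P) : ψ v = 0 ↔ π v = 0 := by
  have hne : ψ.ker ⊔ π.ker ≠ ⊤ := by
    intro h
    obtain ⟨v, hv⟩ := hψ
    have h1 := hsup _ h
    have : v ∈ ψ.ker := by rw [h1]; trivial
    exact hv this
  exact ⟨ker_le_ker ψ π hne (V_eq_bot_or_top ht1 htp) v,
    ker_le_ker π ψ (by rwa [sup_comm]) (V_eq_bot_or_top hs1 hsp) v⟩

end Cover

/-! ### Homomorphisms to simple modules and the invariant linear forms -/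

section CoverMaps

variable {p : ℕ} {F : Type*} [Field F] [CharP F p] {P : Type*} [AddCommGroup P] [Module F P]
  {σ : Representation F (G p)ᵐᵒᵖ P} {t : ℕ} {π : σ.IntertwiningMap (V p F t)}

/-- A nonzero map would be onto with the same kernel as `π`, forcing `dim V_s = dim V_t`, that is `s
= t`. -/
theorem map_V_eq_zero [Module.Finite F P] (hπ : Function.Surjective π)
    (hsup : ∀ X : Subrepresentation σ, X ⊔ π.ker = ⊤ → X = ⊤) (ht1 : 1 ≤ t) (htp : t ≤ p) {s : ℕ}
    (hs1 : 1 ≤ s) (hsp : s ≤ p) (hst : s ≠ t) (ψ : σ.IntertwiningMap (V p F s)) (v : P) :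
    ψ v = 0 := by
  by_contra hv
  have hker := ker_eq_of_ne_zero hsup ht1 htp hs1 hsp ψ ⟨v, hv⟩
  have hψ : Function.Surjective ψ := by
    have h1 : ψ.range = ⊤ := V_subrep_eq_top hs1 hsp _ ⟨v, rfl⟩ hv
    intro x
    have : x ∈ ψ.range := by rw [h1]; trivial
    exact this
  have hk : LinearMap.ker ψ.toLinearMap = LinearMap.ker π.toLinearMap := by
    ext x
    exact hker x
  have h1 := LinearMap.finrank_range_add_finrank_ker ψ.toLinearMap
  have h2 := LinearMap.finrank_range_add_finrank_ker π.toLinearMap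
  rw [LinearMap.range_eq_top.mpr hψ, finrank_top, finrank_V hs1] at h1
  rw [LinearMap.range_eq_top.mpr hπ, finrank_top, finrank_V ht1, ← hk] at h2
  omega

/-- Schur's lemma: take an eigenvalue `c` of `ψ` composed with a linear section `r` of `π`. Then `ψ
- c • π` kills a vector outside `π.ker`, so its kernel is not that of `π` and it must vanish. -/
theorem exists_map_V_eq_smul [IsAlgClosed F] (hπ : Function.Surjective π)
    (hsup : ∀ X : Subrepresentation σ, X ⊔ π.ker = ⊤ → X = ⊤) (ht1 : 1 ≤ t) (htp : t ≤ p)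
    (ψ : σ.IntertwiningMap (V p F t)) : ∃ c : F, ∀ v, ψ v = c • π v := by
  have := finite_V (p := p) (F := F) ht1
  have : Nontrivial (VSub p F t).toSubmodule :=
    Module.nontrivial_of_finrank_pos (R := F) (by rw [finrank_V ht1]; exact ht1)
  obtain ⟨r, hr⟩ := π.toLinearMap.exists_rightInverse_of_surjective (LinearMap.range_eq_top.mpr hπ)
  obtain ⟨c, hc⟩ := Module.End.exists_eigenvalue
    (ψ.toLinearMap ∘ₗ r : Module.End F (VSub p F t).toSubmodule)
  obtain ⟨x, hx⟩ := hc.exists_hasEigenvector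
  have hπx : π (r x) = x := LinearMap.congr_fun hr x
  have hψx : ψ (r x) = c • x := hx.apply_eq_smul
  refine ⟨c, fun v => ?_⟩
  by_contra hv
  have hker := ker_eq_of_ne_zero hsup ht1 htp ht1 htp (ψ - c • π) ⟨v, by
    intro h
    exact hv (sub_eq_zero.mp h)⟩ (r x)
  have h0 : (ψ - c • π) (r x) = 0 := by
    change ψ (r x) - c • π (r x) = 0
    rw [hψx, hπx, sub_self]
  exact hx.2 (hπx.symm.trans (hker.mp h0))

variable [Fact p.Prime]

/-- The linear forms on the projective cover of `V_t` that are invariant under `g` are spanned by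
the two that come from `V_t → funSub (t - 1)` and from a lift along `funSub (p - t) → V_t`. -/
theorem mem_of_g_invariant [IsAlgClosed F] [Module.Finite F P] (hπ : Function.Surjective π)
    (hsup : ∀ X : Subrepresentation σ, X ⊔ π.ker = ⊤ → X = ⊤) (ht1 : 1 ≤ t) (htp : t ≤ p)
    (S : Submodule F (P →ₗ[F] F)) (hS₁ : t < p → evalE ((evalMap p F t).comp π) ∈ S)
    (hS₂ : 2 ≤ t → ∃ Ψ : σ.IntertwiningMap (funRep p F),
      (∀ v, Ψ v ∈ (funSub p F (p - t)).toSubmodule) ∧ (∀ v, sumMap p F t (Ψ v) = π v) ∧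
        evalE Ψ ∈ S)
    {f : P →ₗ[F] F} (hf : ∀ v, f (σ (op (g p).1) v) = f v) : f ∈ S := by
  -- Exactness: a map killed by `sumMap` factors through `V_{d+1}`, hence is zero or a multiple of
  -- the first form.
  have key₁ : ∀ (d s : ℕ), d + s = p → 2 ≤ s → ∀ Φ : σ.IntertwiningMap (funRep p F),
      (∀ v, Φ v ∈ (funSub p F d).toSubmodule) → (∀ v, sumMap p F s (Φ v) = 0) → evalE Φ ∈ S := by
    intro d s hds hs Φ hΦ hΦ0
    obtain ⟨ψ, hψ⟩ := exists_factor (evalMap p F (d + 1))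
      (evalMap_injective (by omega) (by omega)) Φ
      (fun v => exists_evalMap_eq hds hs (hΦ v) (hΦ0 v))
    by_cases hdt : d + 1 = t
    · subst hdt
      obtain ⟨c, hc⟩ := exists_map_V_eq_smul hπ hsup ht1 htp ψ
      have : evalE Φ = c • evalE ((evalMap p F (d + 1)).comp π) := by
        ext v
        rw [LinearMap.smul_apply, evalE_apply, evalE_apply, ← hψ, hc, map_smul]
        rfl
      rw [this]
      exact S.smul_mem _ (hS₁ (by omega))
    · have : evalE Φ = 0 := by
        ext v
        rw [evalE_apply, ← hψ, map_V_eq_zero hπ hsup ht1 htp (by omega) (by omega) hdt ψ, map_zero]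
        rfl
      rw [this]
      exact S.zero_mem
  -- Composition with `sumMap` gives a map to `V_s`: zero unless `s = t`, and otherwise `c • π`, so
  -- subtracting `c • Ψ` reduces to `key₁`.
  have key₂ : ∀ (d s : ℕ), d + s = p → 2 ≤ s → ∀ Φ : σ.IntertwiningMap (funRep p F),
      (∀ v, Φ v ∈ (funSub p F d).toSubmodule) → evalE Φ ∈ S := by
    intro d s hds hs Φ hΦ
    by_cases hst : s = t
    · subst hst
      obtain ⟨Ψ, hΨ, hΨπ, hΨS⟩ := hS₂ hs
      obtain ⟨c, hc⟩ := exists_map_V_eq_smul hπ hsup ht1 htp ((sumMap p F s).comp Φ)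
      have hd : p - s = d := by omega
      rw [hd] at hΨ
      have h1 := key₁ d s hds hs (Φ - c • Ψ)
        (fun v => Submodule.sub_mem _ (hΦ v) (Submodule.smul_mem _ c (hΨ v))) (fun v => by
          change sumMap p F s (Φ v - c • Ψ v) = 0
          rw [map_sub, map_smul, hΨπ, ← hc]
          exact sub_self _)
      have h2 : evalE Φ = evalE (Φ - c • Ψ) + c • evalE Ψ := by
        ext v
        change Φ v ![1, 0] = (Φ v ![1, 0] - c • Ψ v ![1, 0]) + c • Ψ v ![1, 0]
        rw [sub_add_cancel]
      rw [h2]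
      exact S.add_mem h1 (S.smul_mem _ hΨS)
    · exact key₁ d s hds hs Φ hΦ fun v =>
        map_V_eq_zero hπ hsup ht1 htp (by omega) (by omega) hst ((sumMap p F s).comp Φ) v
  obtain ⟨Φ, hΦ0, hΦf⟩ := exists_frobenius hf
  have hfS : f = -∑ d ∈ Finset.range (p - 1), evalE ((component p F d).comp Φ) := by
    ext v
    rw [LinearMap.neg_apply, LinearMap.sum_apply]
    have h1 := congrFun (sum_component (Φ v)) ![1, 0]
    rw [Finset.sum_apply, Pi.neg_apply, hΦf] at h1
    rw [eq_neg_iff_add_eq_zero, ← neg_eq_iff_add_eq_zero, ← h1]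
    rfl
  rw [hfS]
  refine S.neg_mem (S.sum_mem fun d hd => ?_)
  have hd' := Finset.mem_range.mp hd
  exact key₂ d (p - d) (by omega) (by omega) _ fun v => component_mem_funSub d (hΦ0 v)

theorem exists_lift_sumMap (hσ : Module.Projective (MonoidAlgebra F (G p)ᵐᵒᵖ) σ.asModule)
    (ht : 2 ≤ t) (htp : t ≤ p) : ∃ Ψ : σ.IntertwiningMap (funRep p F),
      (∀ v, Ψ v ∈ (funSub p F (p - t)).toSubmodule) ∧ ∀ v, sumMap p F t (Ψ v) = π v := by
  obtain ⟨k, hk⟩ := exists_lift hσ (sumMapSub p F (p - t) t)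
    (sumMapSub_surjective (by omega) ht) π
  exact ⟨{ toLinearMap := (funSub p F (p - t)).toSubmodule.subtype ∘ₗ k.toLinearMap
           isIntertwining' := fun A => LinearMap.ext fun v =>
            congrArg Subtype.val (map_apply_rep k A v) }, fun v => (k v).2, hk⟩

/-- The two linear forms are linearly independent. -/
theorem evalE_independent (hπ : Function.Surjective π) (ht : 2 ≤ t) (htp : t < p)
    {Ψ : σ.IntertwiningMap (funRep p F)} (hΨ : ∀ v, Ψ v ∈ (funSub p F (p - t)).toSubmodule)
    (hΨπ : ∀ v, sumMap p F t (Ψ v) = π v) {a b : F}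
    (h : a • evalE ((evalMap p F t).comp π) + b • evalE Ψ = 0) : a = 0 ∧ b = 0 := by
  have : Nontrivial (VSub p F t).toSubmodule :=
    Module.nontrivial_of_finrank_pos (R := F) (by rw [finrank_V (by omega)]; omega)
  obtain ⟨x, hx⟩ := exists_ne (0 : (VSub p F t).toSubmodule)
  obtain ⟨v, rfl⟩ := hπ x
  have h1 : a • evalMap p F t (π v) + b • Ψ v = 0 :=
    eq_zero_of_evalE_eq_zero (Φ := a • (evalMap p F t).comp π + b • Ψ)
      (fun v => by
        change a • evalMap p F t (π v) 0 + b • Ψ v 0 = 0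
        rw [(hΨ v).1, evalMap_apply, if_pos rfl, smul_zero, smul_zero, add_zero]) h v
  -- `sumMap` kills the evaluation map and sends `Ψ` to `π`, which separates the two coefficients.
  have hb : b = 0 := by
    have h2 := congrArg (sumMap p F t) h1
    rw [map_add, map_smul, map_smul, map_zero, hΨπ, sumMap_evalMap ht (by omega), smul_zero,
      zero_add] at h2
    exact (smul_eq_zero.mp h2).resolve_right hx
  rw [hb, zero_smul, add_zero, smul_eq_zero] at h1
  refine ⟨h1.resolve_right fun h0 => hx ?_, hb⟩
  exact evalMap_injective (by omega) htp.le (h0.trans (map_zero _).symm)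

end CoverMaps

/-! ### The dimension of the projective cover -/

section Dimension

/-- `f ^ n` maps the kernel of `f ^ (n + 1)` into that of `f`, and what it kills lies in the kernel
of `f ^ n`. -/
theorem finrank_ker_pow_le {F P : Type*} [Field F] [AddCommGroup P] [Module F P]
    [Module.Finite F P] (f : Module.End F P) (n : ℕ) :
    Module.finrank F (LinearMap.ker (f ^ n)) ≤ n * Module.finrank F (LinearMap.ker f) := by
  induction n with
  | zero =>
    have : LinearMap.ker (f ^ 0) = ⊥ := by
      rw [pow_zero]
      exact LinearMap.ker_id
    rw [this, finrank_bot, zero_mul]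
  | succ n ih =>
    let h : LinearMap.ker (f ^ (n + 1)) →ₗ[F] LinearMap.ker f :=
      ((f ^ n).domRestrict _).codRestrict _ fun x => by
        have h0 : (f ^ (n + 1)) (x : P) = 0 := x.2
        exact (LinearMap.congr_fun (pow_succ' f n) (x : P)).symm.trans h0
    have h1 := LinearMap.finrank_range_add_finrank_ker h
    have h2 : Module.finrank F (LinearMap.ker h) ≤ Module.finrank F (LinearMap.ker (f ^ n)) := by
      let k : LinearMap.ker h →ₗ[F] LinearMap.ker (f ^ n) :=
        ((LinearMap.ker (f ^ (n + 1))).subtype ∘ₗ (LinearMap.ker h).subtype).codRestrict _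
          fun x => congrArg Subtype.val x.2
      exact LinearMap.finrank_le_finrank_of_injective (f := k) fun x y hxy =>
        Subtype.ext (Subtype.ext (congrArg (fun z : LinearMap.ker (f ^ n) => (z : P)) hxy))
    have h3 := Submodule.finrank_le (LinearMap.range h)
    rw [add_mul, one_mul]
    omega

variable {p : ℕ} [Fact p.Prime] {F : Type*} [Field F] [CharP F p] {P : Type*} [AddCommGroup P]
  [Module F P]

theorem g_pow_p : g p ^ p = 1 := by
  apply Subtype.ext
  apply Subtype.ext
  rw [g_pow_coe]
  ext i j
  fin_cases i <;> fin_cases j <;> simp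

/-- For `N = g - 1`, characteristic `p` gives `N ^ p = g ^ p - 1 = 0`, so `dim P ≤ p · dim ker N`.
The kernel has the dimension of the annihilator of the range, which consists of invariant forms. -/
theorem finrank_le_of_g_invariant [Module.Finite F P] (ρ : Representation F (B p)ᵐᵒᵖ P)
    (S : Submodule F (P →ₗ[F] F))
    (hS : ∀ f : P →ₗ[F] F, (∀ v, f (ρ (op (g p)) v) = f v) → f ∈ S) :
    Module.finrank F P ≤ p * Module.finrank F S := by
  rcases subsingleton_or_nontrivial P with hP | hP
  · rw [Module.finrank_zero_of_subsingleton]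
    exact Nat.zero_le _
  let N : Module.End F P := ρ (op (g p)) - 1
  have hN : N ^ p = 0 := by
    have : CharP (Module.End F P) p :=
      charP_of_injective_algebraMap (algebraMap F (Module.End F P)).injective p
    rw [sub_pow_char_of_commute _ (Commute.one_right _), ← map_pow, ← op_pow, g_pow_p, op_one,
      map_one, one_pow, sub_self]
  have h1 := finrank_ker_pow_le N p
  rw [hN, LinearMap.ker_zero, finrank_top] at h1
  refine h1.trans (Nat.mul_le_mul_left p ?_)
  have h2 := LinearMap.finrank_range_add_finrank_ker N
  have h3 := Subspace.finrank_add_finrank_dualAnnihilator_eq (LinearMap.range N)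
  have h4 : (LinearMap.range N).dualAnnihilator ≤ S := by
    intro f hf
    refine hS f fun v => ?_
    have := (Submodule.mem_dualAnnihilator f).mp hf (N v) ⟨v, rfl⟩
    rw [← sub_eq_zero, ← map_sub]
    exact this
  have h5 : Module.finrank F (LinearMap.ker N) =
      Module.finrank F (LinearMap.range N).dualAnnihilator := by omega
  rw [h5]
  exact Submodule.finrank_mono h4

end Dimension

/-! ### Tops of `F[B]`-modules -/

section Top

variable {p : ℕ} {F : Type*} [Field F] [CharP F p]

/-- The one-dimensional representation of `B` in which `(α β; 0 α⁻¹)` acts as `α ^ a`. -/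
def charRep (p : ℕ) (F : Type*) [Field F] [CharP F p] (a : ℤ) :
    Representation F (B p)ᵐᵒᵖ F where
  toFun b := LinearMap.lsmul F F (ZMod.castHom (dvd_refl p) F (b.unop.1.1 0 0) ^ a)
  map_one' := by
    ext
    simp
  map_mul' b b' := by
    refine LinearMap.ext fun x => ?_
    change ZMod.castHom (dvd_refl p) F ((b'.unop * b.unop).1.1 0 0) ^ a * x =
      ZMod.castHom (dvd_refl p) F (b.unop.1.1 0 0) ^ a *
        (ZMod.castHom (dvd_refl p) F (b'.unop.1.1 0 0) ^ a * x)
    rw [B_mul_apply_zero_zero, map_mul, mul_zpow]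
    ring

theorem charRep_apply (a : ℤ) (b : B p) (x : F) : charRep p F a (op b) x =
    ZMod.castHom (dvd_refl p) F (b.1.1 0 0) ^ a * x := rfl

theorem lam_pow (ζ : (ZMod p)ˣ) (i : ℕ) : lam ζ ^ i = lam (ζ ^ i) := by
  induction i with
  | zero =>
    apply Subtype.ext
    apply Subtype.ext
    ext i j
    fin_cases i <;> fin_cases j <;> simp [lam]
  | succ i ih =>
    have h1 : (lam ζ ^ (i + 1)).1.1 = (lam (ζ ^ i)).1.1 * (lam ζ).1.1 := by
      rw [pow_succ, ih]; rfl
    apply Subtype.ext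
    apply Subtype.ext
    rw [h1]
    ext j k
    fin_cases j <;> fin_cases k <;>
      simp [lam, pow_succ, mul_comm, Matrix.mul_apply, Fin.sum_univ_two]

variable [Fact p.Prime]

theorem exists_eq_lam_pow_mul_g_pow {ζ : (ZMod p)ˣ} (hζ : ∀ x : (ZMod p)ˣ, x ∈ Subgroup.zpowers ζ)
    (b : B p) : ∃ i j : ℕ, b = lam ζ ^ i * g p ^ j := by
  let α : (ZMod p)ˣ := Units.mk0 _ (left_ne_zero_of_mul_eq_one (B_apply_mul b))
  obtain ⟨i, hi⟩ := mem_powers_iff_mem_zpowers.mpr (hζ α)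
  have hi' : ζ ^ i = α := hi
  obtain ⟨j, hj⟩ := exists_eq_mul_g_pow (A := (lam α).1) (A' := b.1) (by
    rw [B_mulVec_e, B_mulVec_e]
    rfl)
  refine ⟨i, j, ?_⟩
  rw [lam_pow, hi']
  exact Subtype.ext hj

theorem apply_B_of_apply_g_of_apply_lam {M : Type*} [AddCommGroup M] [Module F M]
    {ρ : Representation F (B p)ᵐᵒᵖ M} {ζ : (ZMod p)ˣ}
    (hζ : ∀ x : (ZMod p)ˣ, x ∈ Subgroup.zpowers ζ) {a : ℤ} {f : M →ₗ[F] F}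
    (hg : ∀ v, f (ρ (op (g p)) v) = f v)
    (hl : ∀ v, f (ρ (op (lam ζ)) v) = ZMod.castHom (dvd_refl p) F (ζ : ZMod p) ^ a * f v)
    (b : B p) (v : M) :
    f (ρ (op b) v) = ZMod.castHom (dvd_refl p) F (b.1.1 0 0) ^ a * f v := by
  obtain ⟨i, j, rfl⟩ := exists_eq_lam_pow_mul_g_pow hζ b
  have h1 : (lam ζ ^ i * g p ^ j).1.1 0 0 = (ζ : ZMod p) ^ i := by
    rw [B_mul_apply_zero_zero, g_pow_coe, lam_pow]
    simp [lam]
  rw [h1, op_mul, map_mul, Module.End.mul_apply, apply_g_pow hg, map_pow]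
  clear h1
  induction i generalizing v with
  | zero => simp
  | succ i ih =>
    rw [pow_succ, op_mul, map_mul, Module.End.mul_apply, hl, ih, pow_succ, mul_zpow]
    ring

/-- The top of `U_{a,p}` is `S_a`. -/
theorem IsU.exists_top {M : Type*} [AddCommGroup M] [Module F M]
    {ρ : Representation F (B p)ᵐᵒᵖ M} {ζ : (ZMod p)ˣ}
    (hζ : ∀ x : (ZMod p)ˣ, x ∈ Subgroup.zpowers ζ) {a : ℤ} (hρ : IsU ζ a p ρ) :
    ∃ τ : ρ.IntertwiningMap (charRep p F a), Function.Surjective τ ∧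
      ∀ X : Subrepresentation ρ, X ⊔ τ.ker = ⊤ → X = ⊤ := by
  obtain ⟨huni, -, W, -, htop, hW⟩ := hρ
  have hp := (Fact.out : p.Prime).one_le
  let i : Fin p := ⟨p - 1, by omega⟩
  obtain ⟨-, hfin, hg, hl⟩ := hW i
  have hi : W i.succ = ⊤ := by
    rw [← htop]
    congr 1
    ext
    simp [i]
    omega
  have hmem : ∀ v, v ∈ (W i.succ).toSubmodule := fun v => by rw [hi]; trivial
  have := Module.finite_of_finrank_pos (hfin.trans_gt one_pos)
  let e := LinearEquiv.ofFinrankEq _ F (hfin.trans (Module.finrank_self F).symm)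
  let τ : M →ₗ[F] F := e.toLinearMap ∘ₗ Submodule.mkQ _ ∘ₗ
    (LinearMap.id.codRestrict (W i.succ).toSubmodule hmem)
  have hz : ZMod.castHom (dvd_refl p) F (ζ : ZMod p) ≠ 0 := (ζ.isUnit.map _).ne_zero
  -- The top factor is `S_{a+2(p-1)}`, which equals `S_a` by Fermat.
  have hpow : ZMod.castHom (dvd_refl p) F (ζ : ZMod p) ^ (a + 2 * ((i : ℕ) : ℤ)) =
      ZMod.castHom (dvd_refl p) F (ζ : ZMod p) ^ a := by
    rw [zpow_add₀ hz, mul_comm 2, _root_.zpow_mul, zpow_natCast, ← map_pow,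
      ZMod.pow_card_sub_one_eq_one ζ.ne_zero, map_one, _root_.one_zpow, mul_one]
  have hτg : ∀ v, τ (ρ (op (g p)) v) = τ v := fun v =>
    congrArg e (hg (Submodule.Quotient.mk ⟨v, hmem v⟩))
  have hτl : ∀ v, τ (ρ (op (lam ζ)) v) =
      ZMod.castHom (dvd_refl p) F (ζ : ZMod p) ^ a * τ v := fun v => by
    have := congrArg e (hl (Submodule.Quotient.mk ⟨v, hmem v⟩))
    rw [hpow, map_smul] at this
    exact this
  let τ' : ρ.IntertwiningMap (charRep p F a) :=
    { toLinearMap := τ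
      isIntertwining' := fun b => LinearMap.ext fun v =>
        apply_B_of_apply_g_of_apply_lam hζ hτg hτl b.unop v }
  have hsurj : Function.Surjective τ' := by
    intro x
    obtain ⟨y, rfl⟩ := e.surjective x
    obtain ⟨v, rfl⟩ := Submodule.Quotient.mk_surjective _ y
    exact ⟨v.1, rfl⟩
  have hker : ∀ v, τ' v = 0 ↔ v ∈ (W i.castSucc).toSubmodule := by
    intro v
    change e (Submodule.Quotient.mk ⟨v, hmem v⟩) = 0 ↔ _
    rw [e.map_eq_zero_iff, Submodule.Quotient.mk_eq_zero]
    rfl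
  refine ⟨τ', hsurj, fun X hX => ?_⟩
  -- By uniseriality `X` either lies in the kernel of the top map, which is then not onto, or
  -- contains it.
  rcases huni X (W i.castSucc) with hle | hle
  · obtain ⟨v, hv⟩ := hsurj 1
    obtain ⟨x, hx, hxv⟩ := (sup_ker_eq_top_iff τ' X).mp hX v
    rw [(hker x).mpr (hle hx), hv] at hxv
    exact absurd hxv zero_ne_one
  · have h1 : τ'.ker ≤ X := fun v hv => hle ((hker v).mp hv)
    rwa [sup_eq_left.mpr h1] at hX

end Top

/-! ### Comparison of tops -/

section Compare

variable {F K M M₁ M₂ N₁ N₂ : Type*} [Field F] [Group K] [AddCommGroup M] [Module F M]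
  [AddCommGroup M₁] [Module F M₁] [AddCommGroup M₂] [Module F M₂]
  [AddCommGroup N₁] [Module F N₁] [AddCommGroup N₂] [Module F N₂]
  {ρ₁ : Representation F K M₁} {ρ₂ : Representation F K M₂}
  {τ₁ : Representation F K N₁} {τ₂ : Representation F K N₂}

/-- The product of two intertwining maps. -/
def prodMap (f₁ : ρ₁.IntertwiningMap τ₁) (f₂ : ρ₂.IntertwiningMap τ₂) :
    (ρ₁.prod ρ₂).IntertwiningMap (τ₁.prod τ₂) where
  toLinearMap := f₁.toLinearMap.prodMap f₂.toLinearMap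
  isIntertwining' h := LinearMap.ext fun v =>
    Prod.ext (map_apply_rep f₁ h v.1) (map_apply_rep f₂ h v.2)

theorem prodMap_apply (f₁ : ρ₁.IntertwiningMap τ₁) (f₂ : ρ₂.IntertwiningMap τ₂) (v : M₁ × M₂) :
    prodMap f₁ f₂ v = (f₁ v.1, f₂ v.2) := rfl

/-- The product of two maps with superfluous kernels has a superfluous kernel. -/
theorem prodMap_superfluous {f₁ : ρ₁.IntertwiningMap τ₁} {f₂ : ρ₂.IntertwiningMap τ₂}
    (h₁ : ∀ X : Subrepresentation ρ₁, X ⊔ f₁.ker = ⊤ → X = ⊤)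
    (h₂ : ∀ X : Subrepresentation ρ₂, X ⊔ f₂.ker = ⊤ → X = ⊤)
    (X : Subrepresentation (ρ₁.prod ρ₂)) (hX : X ⊔ (prodMap f₁ f₂).ker = ⊤) : X = ⊤ := by
  rw [sup_ker_eq_top_iff] at hX
  -- Second coordinates of the elements of `X` whose first coordinate is in `f₁.ker`. Showing `Y =
  -- ⊤` first lets second coordinates be corrected without changing the image under `f₁`.
  let Y : Subrepresentation ρ₂ :=
    { toSubmodule := (X.toSubmodule ⊓ (LinearMap.ker f₁.toLinearMap).prod ⊤).map
        (LinearMap.snd F M₁ M₂)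
      apply_mem_toSubmodule := by
        rintro h _ ⟨x, ⟨hx, hx1, -⟩, rfl⟩
        refine ⟨(ρ₁.prod ρ₂) h x, ⟨X.apply_mem_toSubmodule h hx, ?_, trivial⟩, rfl⟩
        exact f₁.ker.apply_mem_toSubmodule h hx1 }
  have hY : Y = ⊤ := by
    refine h₂ Y ((sup_ker_eq_top_iff f₂ Y).mpr fun v => ?_)
    obtain ⟨x, hx, hxv⟩ := hX (0, v)
    rw [prodMap_apply, prodMap_apply, map_zero] at hxv
    exact ⟨x.2, ⟨x, ⟨hx, congrArg Prod.fst hxv, trivial⟩, rfl⟩, congrArg Prod.snd hxv⟩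
  have hY' : ∀ v : M₂, ∃ u : M₁, f₁ u = 0 ∧ (u, v) ∈ X := by
    intro v
    have : v ∈ Y := by rw [hY]; trivial
    obtain ⟨x, ⟨hx, hx1, -⟩, rfl⟩ := this
    exact ⟨x.1, hx1, hx⟩
  let Z : Subrepresentation ρ₁ :=
    { toSubmodule := X.toSubmodule.comap (LinearMap.inl F M₁ M₂)
      apply_mem_toSubmodule := fun h x hx => by
        have h3 := X.apply_mem_toSubmodule h hx
        have h4 : (ρ₁.prod ρ₂) h (x, 0) = (ρ₁ h x, 0) :=
          Prod.ext rfl (map_zero (ρ₂ h))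
        change (ρ₁ h x, (0 : M₂)) ∈ X.toSubmodule
        rw [← h4]
        exact h3 }
  have hZ : Z = ⊤ := by
    refine h₁ Z ((sup_ker_eq_top_iff f₁ Z).mpr fun v => ?_)
    obtain ⟨x, hx, hxv⟩ := hX (v, 0)
    obtain ⟨u, hu, hux⟩ := hY' x.2
    refine ⟨x.1 - u, ?_, ?_⟩
    · have h3 := X.toSubmodule.sub_mem hx hux
      have h4 : x - (u, x.2) = (x.1 - u, 0) := Prod.ext rfl (sub_self _)
      rw [h4] at h3
      exact h3
    · rw [map_sub, hu, sub_zero]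
      exact congrArg Prod.fst hxv
  refine top_unique fun v _ => ?_
  obtain ⟨u, -, huv⟩ := hY' v.2
  have h3 : v.1 - u ∈ Z := by rw [hZ]; trivial
  have h4 := X.toSubmodule.add_mem (show (v.1 - u, (0 : M₂)) ∈ X.toSubmodule from h3) huv
  have h5 : (v.1 - u, (0 : M₂)) + (u, v.2) = v := Prod.ext (sub_add_cancel _ _) (zero_add _)
  rw [h5] at h4
  exact h4

/-- A lift of an epimorphism along an epimorphism with superfluous kernel is an isomorphism if
the dimensions allow it. -/
theorem nonempty_equiv_of_lift [Module.Finite F M] [Module.Finite F M₁]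
    {ρ : Representation F K M} (f : ρ₁.IntertwiningMap τ₁)
    (hsup : ∀ X : Subrepresentation ρ₁, X ⊔ f.ker = ⊤ → X = ⊤) (h : ρ.IntertwiningMap τ₁)
    (hh : Function.Surjective h) (k : ρ.IntertwiningMap ρ₁) (hk : ∀ v, f (k v) = h v)
    (hle : Module.finrank F M ≤ Module.finrank F M₁) : Nonempty (ρ.Equiv ρ₁) := by
  have h1 : k.range = ⊤ := hsup _ <| (sup_ker_eq_top_iff f _).mpr fun v => by
    obtain ⟨w, hw⟩ := hh (f v)
    exact ⟨k w, ⟨w, rfl⟩, (hk w).trans hw⟩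
  have hsurj : Function.Surjective k := fun v => by
    have : v ∈ k.range := by rw [h1]; trivial
    exact this
  have hge := LinearMap.finrank_le_finrank_of_surjective (f := k.toLinearMap) hsurj
  have hinj : Function.Injective k :=
    (LinearMap.injective_iff_surjective_of_finrank_eq_finrank (f := k.toLinearMap)
      (le_antisymm hle hge)).mpr hsurj
  exact ⟨Representation.IntertwiningMap.ofBijective k ⟨hinj, hsurj⟩⟩

end Compare

/-! ### The restriction of the projective cover -/

section Restriction

variable {p : ℕ} {F : Type*} [Field F]
  {P : Type*} [AddCommGroup P] [Module F P] {σ : Representation F (G p)ᵐᵒᵖ P}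

/-- A homogeneous map to functions on `𝔽_p²` gives a map from the restriction to `B` to a
one-dimensional representation. -/
def resMap [Fact p.Prime] [CharP F p] (Φ : σ.IntertwiningMap (funRep p F)) {d : ℕ}
    (hΦ : ∀ v, Φ v ∈ (funSub p F d).toSubmodule) :
    (res σ).IntertwiningMap (charRep p F d) where
  toLinearMap := evalE Φ
  isIntertwining' b := LinearMap.ext fun v => by
    change evalE Φ (σ (op b.unop.1) v) = charRep p F d (op b.unop) (evalE Φ v)
    rw [evalE_apply_B hΦ, charRep_apply, zpow_natCast]

theorem finite_G_op [NeZero p] : Finite (G p)ᵐᵒᵖ :=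
  have : Finite (G p) := Finite.of_injective (fun A : G p => A.1) Subtype.val_injective
  Finite.of_injective unop unop_injective

theorem exists_lift_res (hσ : Module.Projective (MonoidAlgebra F (G p)ᵐᵒᵖ) σ.asModule)
    {M N : Type*} [AddCommGroup M] [Module F M] [AddCommGroup N] [Module F N]
    {ρ : Representation F (B p)ᵐᵒᵖ M} {τ : Representation F (B p)ᵐᵒᵖ N}
    (f : ρ.IntertwiningMap τ) (hf : Function.Surjective f) (h : (res σ).IntertwiningMap τ) :
    ∃ k : (res σ).IntertwiningMap ρ, ∀ v, f (k v) = h v :=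
  exists_lift_comp (φ := MonoidHom.op (B p).subtype)
    (fun _ _ hab => unop_injective (Subtype.ext (op_injective hab))) hσ f hf h

/-- The case of a one-dimensional space of invariant forms: `resMap Φ` lifts through the top of
`U_{d,p}`, and `dim P ≤ p`. -/
theorem nonempty_equiv_of_evalE [Fact p.Prime] [CharP F p] {ζ : (ZMod p)ˣ}
    (hζ : ∀ x : (ZMod p)ˣ, x ∈ Subgroup.zpowers ζ)
    [Module.Finite F P] (hσ : Module.Projective (MonoidAlgebra F (G p)ᵐᵒᵖ) σ.asModule)
    {Φ : σ.IntertwiningMap (funRep p F)} {d : ℕ}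
    (hΦ : ∀ v, Φ v ∈ (funSub p F d).toSubmodule) (hne : evalE Φ ≠ 0)
    (hspan : ∀ f : P →ₗ[F] F, (∀ v, f (σ (op (g p).1) v) = f v) →
      f ∈ Submodule.span F {evalE Φ})
    {M : Type*} [AddCommGroup M] [Module F M] {ρ : Representation F (B p)ᵐᵒᵖ M}
    (hρ : IsU ζ d p ρ) : Nonempty ((res σ).Equiv ρ) := by
  obtain ⟨τ, hτ, hsup⟩ := hρ.exists_top hζ
  have hfin := hρ.2.1
  have hp := (Fact.out : p.Prime).pos
  have : Module.Finite F M := Module.finite_of_finrank_pos (by rw [hfin]; exact hp)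
  obtain ⟨k, hk⟩ := exists_lift_res hσ τ hτ (resMap Φ hΦ)
  refine nonempty_equiv_of_lift τ hsup (resMap Φ hΦ) (LinearMap.surjective hne) k hk ?_
  rw [hfin]
  have h1 := finrank_le_of_g_invariant (res σ) _ hspan
  rwa [finrank_span_singleton hne, mul_one] at h1

theorem nonempty_equiv_prod_of_evalE [Fact p.Prime] [CharP F p] {ζ : (ZMod p)ˣ}
    (hζ : ∀ x : (ZMod p)ˣ, x ∈ Subgroup.zpowers ζ)
    [Module.Finite F P] (hσ : Module.Projective (MonoidAlgebra F (G p)ᵐᵒᵖ) σ.asModule)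
    {Φ₁ Φ₂ : σ.IntertwiningMap (funRep p F)} {d₁ d₂ : ℕ}
    (hΦ₁ : ∀ v, Φ₁ v ∈ (funSub p F d₁).toSubmodule)
    (hΦ₂ : ∀ v, Φ₂ v ∈ (funSub p F d₂).toSubmodule)
    (hind : ∀ a b : F, a • evalE Φ₁ + b • evalE Φ₂ = 0 → a = 0 ∧ b = 0)
    (hspan : ∀ f : P →ₗ[F] F, (∀ v, f (σ (op (g p).1) v) = f v) →
      f ∈ Submodule.span F {evalE Φ₁, evalE Φ₂})
    {M₁ M₂ : Type*} [AddCommGroup M₁] [Module F M₁] [AddCommGroup M₂] [Module F M₂]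
    {ρ₁ : Representation F (B p)ᵐᵒᵖ M₁} {ρ₂ : Representation F (B p)ᵐᵒᵖ M₂}
    (hρ₁ : IsU ζ d₁ p ρ₁) (hρ₂ : IsU ζ d₂ p ρ₂) : Nonempty ((res σ).Equiv (ρ₁.prod ρ₂)) := by
  classical
  obtain ⟨τ₁, hτ₁, hsup₁⟩ := hρ₁.exists_top hζ
  obtain ⟨τ₂, hτ₂, hsup₂⟩ := hρ₂.exists_top hζ
  have hfin₁ := hρ₁.2.1
  have hfin₂ := hρ₂.2.1
  have hp := (Fact.out : p.Prime).pos
  have : Module.Finite F M₁ := Module.finite_of_finrank_pos (by rw [hfin₁]; exact hp)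
  have : Module.Finite F M₂ := Module.finite_of_finrank_pos (by rw [hfin₂]; exact hp)
  let h := (resMap Φ₁ hΦ₁).prod (resMap Φ₂ hΦ₂)
  have hh : Function.Surjective h := by
    have h1 : LinearMap.range h.toLinearMap = ⊤ := by
      by_contra hlt
      -- If the pair of forms were not onto `F × F`, a nonzero form vanishing on the image would be
      -- a linear relation between them.
      obtain ⟨f, hf0, hf⟩ := Submodule.exists_le_ker_of_lt_top _ (lt_top_iff_ne_top.mpr hlt)
      have hfx : ∀ x : F × F, f x = f (1, 0) * x.1 + f (0, 1) * x.2 := by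
        intro x
        have hx : x = x.1 • ((1, 0) : F × F) + x.2 • ((0, 1) : F × F) := by
          ext <;> simp
        conv_lhs => rw [hx]
        rw [map_add, map_smul, map_smul, smul_eq_mul, smul_eq_mul, mul_comm, mul_comm x.2]
      obtain ⟨ha, hb⟩ := hind (f (1, 0)) (f (0, 1)) (by
        ext v
        have h2 : f (evalE Φ₁ v, evalE Φ₂ v) = 0 := hf ⟨v, rfl⟩
        rw [hfx] at h2
        exact h2)
      apply hf0
      refine LinearMap.ext fun x => ?_
      rw [hfx, ha, hb, zero_mul, zero_mul, add_zero]
      rfl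
    exact LinearMap.range_eq_top.mp h1
  have hττ : Function.Surjective (prodMap τ₁ τ₂) := by
    rintro ⟨x, y⟩
    obtain ⟨u, rfl⟩ := hτ₁ x
    obtain ⟨v, rfl⟩ := hτ₂ y
    exact ⟨(u, v), rfl⟩
  obtain ⟨k, hk⟩ := exists_lift_res hσ (prodMap τ₁ τ₂) hττ h
  refine nonempty_equiv_of_lift (prodMap τ₁ τ₂) (prodMap_superfluous hsup₁ hsup₂) h hh k hk ?_
  rw [Module.finrank_prod, hfin₁, hfin₂]
  have h1 := finrank_le_of_g_invariant (res σ) _ hspan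
  have h2 : Module.finrank F (Submodule.span F {evalE Φ₁, evalE Φ₂}) ≤ 2 := by
    have h3 := finrank_span_finset_le_card (R := F) ({evalE Φ₁, evalE Φ₂} : Finset (P →ₗ[F] F))
    rw [Finset.coe_pair] at h3
    exact h3.trans Finset.card_le_two
  have h3 := Nat.mul_le_mul_left p h2
  omega

end Restriction

end

end SL2Rep

/-! ### Assembly of the main theorem -/

theorem mainTheorem8 {p : ℕ} [Fact p.Prime] (hp : p ≠ 2)
    {F : Type u} [Field F] [IsAlgClosed F] [CharP F p]
    (ζ : (ZMod p)ˣ) (hζ : ∀ x : (ZMod p)ˣ, x ∈ Subgroup.zpowers ζ)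
    (t : ℕ) (ht1 : 1 ≤ t) (htp : t ≤ p) :
    -- the projective cover of `V_t` and the modules `U_{a,p}` exist
    (∃ (P : Type u) (_ : AddCommGroup P) (_ : Module F P)
      (σ : Representation F (SL2Rep.G p)ᵐᵒᵖ P),
      SL2Rep.IsProjectiveCover σ (SL2Rep.V p F t)) ∧
    (∀ a : ℤ, ∃ (M : Type u) (_ : AddCommGroup M) (_ : Module F M)
      (ρ : Representation F (SL2Rep.B p)ᵐᵒᵖ M), SL2Rep.IsU ζ a p ρ) ∧
    -- the restriction of the projective cover
    ∀ (P : Type v) [AddCommGroup P] [Module F P]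
      (σ : Representation F (SL2Rep.G p)ᵐᵒᵖ P),
      SL2Rep.IsProjectiveCover σ (SL2Rep.V p F t) →
      ((t = 1 ∨ t = p) →
        ∀ (M : Type w) [AddCommGroup M] [Module F M]
          (ρ : Representation F (SL2Rep.B p)ᵐᵒᵖ M),
          SL2Rep.IsU ζ 0 p ρ → Nonempty ((SL2Rep.res σ).Equiv ρ)) ∧
      ((1 < t ∧ t < p) →
        ∀ (M₁ : Type w) [AddCommGroup M₁] [Module F M₁]
          (ρ₁ : Representation F (SL2Rep.B p)ᵐᵒᵖ M₁)
          (M₂ : Type w) [AddCommGroup M₂] [Module F M₂]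
          (ρ₂ : Representation F (SL2Rep.B p)ᵐᵒᵖ M₂),
          SL2Rep.IsU ζ ((t : ℤ) - 1) p ρ₁ → SL2Rep.IsU ζ ((p : ℤ) - t) p ρ₂ →
          Nonempty ((SL2Rep.res σ).Equiv (ρ₁.prod ρ₂))) := by
  have := SL2Rep.finite_G_op (p := p)
  have : Nontrivial (SL2Rep.VSub p F t).toSubmodule :=
    Module.nontrivial_of_finrank_pos (R := F) (by rw [SL2Rep.finrank_V ht1]; exact ht1)
  obtain ⟨x, hx⟩ := exists_ne (0 : (SL2Rep.VSub p F t).toSubmodule)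
  refine ⟨SL2Rep.exists_isProjectiveCover (SL2Rep.V p F t) x
    fun X hX => SL2Rep.V_subrep_eq_top ht1 htp X hX hx, SL2Rep.exists_isU ζ, ?_⟩
  rintro P _ _ σ ⟨hσ, π, hπ, hsup⟩
  obtain ⟨v, rfl⟩ := hπ x
  have : Module.Finite F P := SL2Rep.finite_of_superfluous π hsup v
    fun X hX => SL2Rep.V_subrep_eq_top ht1 htp X hX hx
  have hmem : ∀ w, ((SL2Rep.evalMap p F t).comp π) w ∈ (SL2Rep.funSub p F (t - 1)).toSubmodule :=
    fun w => SL2Rep.evalMap_mem_funSub (π w)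
  refine ⟨?_, ?_⟩
  · rintro (rfl | rfl) M _ _ ρ hρ
    -- For `t = 1` only the form from `evalMap` occurs, in degree `t - 1 = 0`.
    · refine SL2Rep.nonempty_equiv_of_evalE hζ hσ hmem ?_ ?_ hρ
      · intro h0
        have h1 := SL2Rep.eq_zero_of_evalE_eq_zero (fun w => (hmem w).1) h0 v
        exact hx (SL2Rep.evalMap_injective le_rfl htp (h1.trans (map_zero _).symm))
      · exact fun f hf => SL2Rep.mem_of_g_invariant hπ hsup ht1 htp _
          (fun _ => Submodule.mem_span_singleton_self _) (fun h => absurd h (by norm_num)) hf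
    -- For `t = p` (the prime is now called `t`) only the lifted form `Ψ` occurs, in degree `p - t =
    -- 0`.
    · have ht2 : 2 ≤ t := (Fact.out : t.Prime).two_le
      obtain ⟨Ψ, hΨ, hΨπ⟩ := SL2Rep.exists_lift_sumMap (π := π) hσ ht2 le_rfl
      have hΨ0 : ∀ w, Ψ w ∈ (SL2Rep.funSub t F 0).toSubmodule := by
        rwa [Nat.sub_self] at hΨ
      refine SL2Rep.nonempty_equiv_of_evalE hζ hσ hΨ0 ?_ ?_ hρ
      · intro h0
        have h1 := SL2Rep.eq_zero_of_evalE_eq_zero (fun w => (hΨ w).1) h0 v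
        exact hx (by rw [← hΨπ, h1, map_zero])
      · exact fun f hf => SL2Rep.mem_of_g_invariant hπ hsup ht1 htp _
          (fun h => absurd h (lt_irrefl _))
          (fun _ => ⟨Ψ, hΨ, hΨπ, Submodule.mem_span_singleton_self _⟩) hf
  · rintro ⟨h1t, htp'⟩ M₁ _ _ ρ₁ M₂ _ _ ρ₂ hρ₁ hρ₂
    obtain ⟨Ψ, hΨ, hΨπ⟩ := SL2Rep.exists_lift_sumMap (π := π) hσ h1t htp
    have e₁ : (t : ℤ) - 1 = ((t - 1 : ℕ) : ℤ) := by omega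
    have e₂ : (p : ℤ) - t = ((p - t : ℕ) : ℤ) := by omega
    rw [e₁] at hρ₁
    rw [e₂] at hρ₂
    exact SL2Rep.nonempty_equiv_prod_of_evalE hζ hσ hmem hΨ
      (fun a b h => SL2Rep.evalE_independent hπ h1t htp' hΨ hΨπ h)
      (fun f hf => SL2Rep.mem_of_g_invariant hπ hsup ht1 htp _
        (fun _ => Submodule.subset_span (Set.mem_insert _ _))
        (fun _ => ⟨Ψ, hΨ, hΨπ, Submodule.subset_span (Set.mem_insert_of_mem _ (Set.mem_singleton _))⟩) hf) hρ₁ hρ₂
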